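/- There is an absolute constant $C$ such that the following holds for all $s,k\in\mathbb{N}$. Let $G$ be a finite simple graph with at least one vertex that contains no (not necessarily induced) subgraph isomorphic to the complete bipartite graph $K_{s,s}$. If the average degree $d(G)=2|E(G)|/|V(G)|$ of $G$ is at least $k^{Cs^3}$, then there is a non-empty set $S\subseteq V(G)$ such that the induced subgraph $G[S]$ contains no (not necessarily induced) subgraph isomorphic to the $4$-cycle $C_4$ and has average degree $d(G[S])\ge k$. -/

import Mathlib

/-- The average degree `d(G) = 2 e(G) / |V(G)|` of a finite graph. It is only meant for graphs with
a non-empty finite vertex set. -/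
noncomputable def SimpleGraph.avgDegree {V : Type*} (G : SimpleGraph V) : ℝ :=
  2 * (G.edgeSet.ncard : ℝ) / (Nat.card V : ℝ)

namespace InducedC4Free

open Finset
open scoped Classical

variable {V : Type*}

/-! The engine is sampling with deletion: keep each vertex at random and discard the vertices that
still lie on a 4-cycle. If the maximum degree exceeds the average degree only by a moderate power of
`M` (a large power of `k`), then `K_{s,s}`-freeness limits the 4-cycles through each vertex enough
for this to succeed (`hasDenseC4Free_of_degree_le`).

In general the degrees may be too uneven. Take a minimal set `U` of average degree at least `2 * N`,
and repeatedly restrict to the vertices of degree at least `T` (`layer`). Each difference of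
consecutive layers has maximum degree below `T`, so either the engine applies inside it or it is
sparse, and layers shrink by a factor `M` at each step. Hence most edges run between the first
difference `A` and the rest, and a fair share of them goes to a set `Y` that is either one later
difference, hence sparse, or the layer `L`, hence smaller than `U` by a factor `M ^ L`.

In both cases `Y` contains a random independent set `X` that is far smaller than the set of vertices
of `A` with many neighbours in `X`. If `Y` is sparse, a second moment bound gives this
(`prob_card_core_ge`). If `Y` is tiny, an exponentially small survival probability is affordable
(`prob_subset_core_ge`).

There remain very unbalanced bipartite graphs (`hasDenseC4Free_of_bipartite`), handled by induction
on `t`, where every `t`-set of the small side has fewer than `s` common neighbours. Call a pair in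
the small side heavy if its codegree is large. If heavy pairs concentrate at some `u`, restrict to
neighbours of `u` and heavy partners of `u`, which lowers `t`. Otherwise heavy pairs are rare and
sampling the two sides at different rates works (`hasDenseC4Free_of_light_pairs`). -/

/-- The neighbours of `v` inside `S`. -/
noncomputable def nb (G : SimpleGraph V) (S : Finset V) (v : V) : Finset V := {u ∈ S | G.Adj v u}

/-- The number of ordered pairs of adjacent vertices inside `S`. -/
noncomputable def degSum (G : SimpleGraph V) (S : Finset V) : ℕ := ∑ v ∈ S, #(nb G S v)

/-- No `4`-cycle of `G` has all its vertices in `S`. -/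
def C4FreeOn (G : SimpleGraph V) (S : Finset V) : Prop :=
  ∀ v ∈ S, ∀ u ∈ S, ∀ x ∈ S, ∀ w ∈ S, v ≠ x → u ≠ w →
    G.Adj v u → G.Adj u x → G.Adj x w → G.Adj w v → False

/-- `G` has no complete bipartite subgraph with both parts of size `s`. -/
def BicliqueFree (G : SimpleGraph V) (s : ℕ) : Prop :=
  ∀ T X : Finset V, #T = s → #X = s → (∀ t ∈ T, ∀ x ∈ X, G.Adj t x) → False

/-- Some non-empty `S` induces a `C₄`-free subgraph of average degree at least `k`. -/
def HasDenseC4Free (G : SimpleGraph V) (k : ℕ) : Prop :=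
  ∃ S : Finset V, S.Nonempty ∧ C4FreeOn G S ∧ k * #S ≤ degSum G S

/-- No two vertices of `S` are adjacent. -/
def Indep (G : SimpleGraph V) (S : Finset V) : Prop := ∀ u ∈ S, ∀ v ∈ S, ¬ G.Adj u v

/-- Every subset of `A` spans a graph of average degree at most `D`. -/
def SparseOn (G : SimpleGraph V) (A : Finset V) (D : ℕ) : Prop := ∀ H ⊆ A, degSum G H ≤ D * #H

/-! ### Degree sums, sparse sets, greedy independent sets and orientations. -/

variable {G : SimpleGraph V}

@[simp] lemma mem_nb {S : Finset V} {u v : V} : u ∈ nb G S v ↔ u ∈ S ∧ G.Adj v u := by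
  simp [nb]

lemma nb_subset (S : Finset V) (v : V) : nb G S v ⊆ S := filter_subset _ _

lemma nb_mono {S T : Finset V} (h : S ⊆ T) (v : V) : nb G S v ⊆ nb G T v :=
  filter_subset_filter _ h

lemma card_nb_mono {S T : Finset V} (h : S ⊆ T) (v : V) : #(nb G S v) ≤ #(nb G T v) :=
  card_le_card (nb_mono h v)

lemma C4FreeOn.mono {S T : Finset V} (hT : C4FreeOn G T) (h : S ⊆ T) : C4FreeOn G S :=
  fun v hv u hu x hx w hw => hT v (h hv) u (h hu) x (h hx) w (h hw)

lemma Indep.mono {S T : Finset V} (hT : Indep G T) (h : S ⊆ T) : Indep G S :=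
  fun v hv u hu => hT v (h hv) u (h hu)

lemma SparseOn.mono {S T : Finset V} {D : ℕ} (hT : SparseOn G T D) (h : S ⊆ T) : SparseOn G S D :=
  fun H hH => hT H (hH.trans h)

lemma sum_card_nb_comm (A B : Finset V) : ∑ a ∈ A, #(nb G B a) = ∑ b ∈ B, #(nb G A b) := by
  have h := Finset.sum_card_bipartiteAbove_eq_sum_card_bipartiteBelow (s := A) (t := B) G.Adj
  refine h.trans (sum_congr rfl fun b _ => ?_)
  congr 1
  ext a
  simp [bipartiteBelow, G.adj_comm]

lemma card_nb_union {A B : Finset V} (h : Disjoint A B) (v : V) :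
    #(nb G (A ∪ B) v) = #(nb G A v) + #(nb G B v) := by
  rw [nb, filter_union, card_union_of_disjoint (disjoint_filter_filter h)]
  rfl

lemma degSum_union {A B : Finset V} (h : Disjoint A B) :
    degSum G (A ∪ B) = degSum G A + 2 * ∑ a ∈ A, #(nb G B a) + degSum G B := by
  rw [degSum, sum_union h]
  simp only [card_nb_union h, sum_add_distrib]
  rw [← sum_card_nb_comm A B]
  simp only [degSum]
  ring

/-- A sparse set contains a vertex of small inner degree. -/
lemma SparseOn.exists_card_nb_le {A : Finset V} {D : ℕ} (h : SparseOn G A D) (hA : A.Nonempty) :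
    ∃ v ∈ A, #(nb G A v) ≤ D := by
  by_contra! hc
  have h1 : ∑ _v ∈ A, D < ∑ v ∈ A, #(nb G A v) := sum_lt_sum_of_nonempty hA hc
  have h2 := h A subset_rfl
  rw [sum_const, smul_eq_mul, mul_comm] at h1
  exact absurd h2 (not_le.2 h1)

/-- Greedy independent sets, for a set each of whose subsets has a vertex of small degree. -/
lemma exists_indep_of_degenerate {D : ℕ} (A : Finset V)
    (h : ∀ H ⊆ A, H.Nonempty → ∃ v ∈ H, #(nb G H v) ≤ D) :
    ∃ I ⊆ A, Indep G I ∧ #A ≤ (D + 1) * #I := by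
  induction A using Finset.strongInduction with
  | H A ih =>
    rcases A.eq_empty_or_nonempty with rfl | hA
    · exact ⟨∅, subset_rfl, by simp [Indep], by simp⟩
    obtain ⟨v, hv, hd⟩ := h A subset_rfl hA
    set A' := A \ insert v (nb G A v) with hA'
    have hss : A' ⊂ A := by
      refine ⟨sdiff_subset, fun hc => ?_⟩
      have := hc hv
      simp [hA'] at this
    obtain ⟨I, hI, hind, hcard⟩ := ih A' hss fun H hH => h H (hH.trans hss.1)
    have hvI : v ∉ I := fun hc => by have := hI hc; simp [hA'] at this
    have hno : ∀ u ∈ I, ¬ G.Adj v u := fun u hu hadj => by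
      have := hI hu
      simp only [hA', mem_sdiff, mem_insert, mem_nb, not_or, not_and] at this
      exact this.2.2 this.1 hadj
    refine ⟨insert v I, insert_subset hv (hI.trans hss.1), ?_, ?_⟩
    · intro a ha b hb hab
      rw [mem_insert] at ha hb
      rcases ha with rfl | ha <;> rcases hb with rfl | hb
      · exact G.loopless.irrefl _ hab
      · exact hno b hb hab
      · exact hno a ha hab.symm
      · exact hind a ha b hb hab
    · rw [card_insert_of_notMem hvI]
      have h1 : #A ≤ #A' + #(insert v (nb G A v)) := by
        rw [hA']; exact (card_le_card_sdiff_add_card)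
      have h2 : #(insert v (nb G A v)) ≤ D + 1 := (card_insert_le _ _).trans (by omega)
      calc #A ≤ (D + 1) * #I + (D + 1) := by omega
        _ = (D + 1) * (#I + 1) := by ring

lemma SparseOn.exists_indep {A : Finset V} {D : ℕ} (h : SparseOn G A D) :
    ∃ I ⊆ A, Indep G I ∧ #A ≤ (D + 1) * #I :=
  exists_indep_of_degenerate A fun _ hH hne => (h.mono hH).exists_card_nb_le hne

/-- The edges inside a sparse set can be oriented with small out-degrees. -/
lemma SparseOn.exists_orientation {D : ℕ} (A : Finset V) (h : SparseOn G A D) :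
    ∃ out : V → Finset V, (∀ x, out x ⊆ A) ∧ (∀ x ∈ A, #(out x) ≤ D) ∧
      (∀ x ∈ A, ∀ y ∈ out x, G.Adj x y) ∧
      ∀ x ∈ A, ∀ y ∈ A, G.Adj x y → y ∈ out x ∨ x ∈ out y := by
  induction A using Finset.strongInduction with
  | H A ih =>
    rcases A.eq_empty_or_nonempty with rfl | hA
    · exact ⟨fun _ => ∅, by simp, by simp, by simp, by simp⟩
    obtain ⟨v, hv, hd⟩ := h.exists_card_nb_le hA
    obtain ⟨out, h1, h2, h3, h4⟩ := ih (A.erase v) (erase_ssubset hv) (h.mono (erase_subset _ _))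
    -- All edges at the peeled low-degree vertex point out of it.
    refine ⟨fun x => if x = v then nb G A v else out x, ?_, ?_, ?_, ?_⟩
    · intro x
      dsimp only
      split_ifs
      · exact nb_subset _ _
      · exact (h1 x).trans (erase_subset _ _)
    · intro x hx
      dsimp only
      split_ifs with hxv
      · exact hd
      · exact h2 x (mem_erase.2 ⟨hxv, hx⟩)
    · intro x hx y
      dsimp only
      split_ifs with hxv
      · subst hxv; intro hy; exact (mem_nb.1 hy).2
      · exact h3 x (mem_erase.2 ⟨hxv, hx⟩) y
    · intro x hx y hy hxy
      dsimp only
      by_cases hxv : x = v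
      · subst hxv; left; simp [hy, hxy]
      · by_cases hyv : y = v
        · subst hyv; right; simp [hx, hxy.symm]
        · simp only [hxv, hyv, if_false]
          exact h4 x (mem_erase.2 ⟨hxv, hx⟩) y (mem_erase.2 ⟨hyv, hy⟩) hxy

/-! ### Codegree counting in graphs without large bicliques. -/

/-- Few vertices have many neighbours in a given set of a graph without large bicliques. -/
lemma BicliqueFree.card_mul_choose_le {s m : ℕ} (h : BicliqueFree G s) (W X : Finset V)
    (hX : ∀ x ∈ X, m ≤ #(nb G W x)) : #X * m.choose s ≤ s * (#W).choose s := by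
  -- Double counting of pairs `(x, Q)` with `Q` an `s`-set of neighbours of `x`, as for
  -- Kővári–Sós–Turán.
  have h1 : #X * m.choose s ≤ ∑ x ∈ X, #{Q ∈ W.powersetCard s | Q ⊆ nb G W x} := by
    rw [← smul_eq_mul, ← sum_const]
    refine sum_le_sum fun x hx => ?_
    have : ({Q ∈ W.powersetCard s | Q ⊆ nb G W x} : Finset (Finset V))
        = (nb G W x).powersetCard s := by
      ext Q
      simp only [mem_filter, mem_powersetCard]
      constructor
      · rintro ⟨⟨-, h⟩, h'⟩; exact ⟨h', h⟩
      · rintro ⟨h, h'⟩; exact ⟨⟨h.trans (nb_subset _ _), h'⟩, h⟩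
    rw [this, card_powersetCard]
    exact Nat.choose_le_choose s (hX x hx)
  have h2 := Finset.sum_card_bipartiteAbove_eq_sum_card_bipartiteBelow (s := X)
    (t := W.powersetCard s) (fun x Q => Q ⊆ nb G W x)
  simp only [bipartiteAbove, bipartiteBelow] at h2
  rw [h2] at h1
  refine h1.trans ?_
  rw [mul_comm s, ← card_powersetCard s W, ← smul_eq_mul, ← sum_const]
  refine sum_le_sum fun Q hQ => ?_
  by_contra! hc
  obtain ⟨Y, hY, hYc⟩ := exists_subset_card_eq hc.le
  refine h Q Y (mem_powersetCard.1 hQ).2 hYc fun t ht x hx => ?_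
  have := (mem_filter.1 (hY hx)).2 ht
  exact (mem_nb.1 this).2.symm

/-- When `2 * s ≤ m`, every factor of the falling factorial of `m` is at least `m / 2`, so the ratio
of binomials is at most `(2 * #W / m) ^ s`. -/
lemma BicliqueFree.card_mul_pow_le {s m : ℕ} (h : BicliqueFree G s) (W X : Finset V)
    (hm : 2 * s ≤ m) (hX : ∀ x ∈ X, m ≤ #(nb G W x)) : #X * m ^ s ≤ s * (2 * #W) ^ s := by
  have h1 := h.card_mul_choose_le W X hX
  have h2 : m ^ s ≤ 2 ^ s * (s.factorial * m.choose s) := by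
    rw [← Nat.descFactorial_eq_factorial_mul_choose]
    calc m ^ s ≤ (2 * (m + 1 - s)) ^ s := Nat.pow_le_pow_left (by omega) s
      _ = 2 ^ s * (m + 1 - s) ^ s := mul_pow _ _ _
      _ ≤ _ := Nat.mul_le_mul_left _ (Nat.pow_sub_le_descFactorial m s)
  have h3 : s.factorial * (#W).choose s ≤ #W ^ s := by
    rw [← Nat.descFactorial_eq_factorial_mul_choose]
    exact Nat.descFactorial_le_pow _ _
  calc #X * m ^ s ≤ #X * (2 ^ s * (s.factorial * m.choose s)) := Nat.mul_le_mul_left _ h2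
    _ = 2 ^ s * s.factorial * (#X * m.choose s) := by ring
    _ ≤ 2 ^ s * s.factorial * (s * (#W).choose s) := Nat.mul_le_mul_left _ h1
    _ = 2 ^ s * s * (s.factorial * (#W).choose s) := by ring
    _ ≤ 2 ^ s * s * #W ^ s := Nat.mul_le_mul_left _ h3
    _ = s * (2 * #W) ^ s := by rw [mul_pow]; ring

/-- The case of `BicliqueFree.card_mul_pow_le` in which the degrees are powers of a base. -/
lemma BicliqueFree.card_le_pow {s M a j : ℕ} (h : BicliqueFree G s) (W X : Finset V)
    (hM : 2 ≤ M) (hs : s ≤ M) (ha : 2 * s ≤ M ^ a) (hW : #W ≤ M ^ (a + j))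
    (hX : ∀ x ∈ X, M ^ a ≤ #(nb G W x)) : #X ≤ M ^ ((j + 1) * s + 1) := by
  have h1 := h.card_mul_pow_le W X ha hX
  have hpos : 0 < (M ^ a) ^ s := by positivity
  refine Nat.le_of_mul_le_mul_right (h1.trans ?_) hpos
  calc s * (2 * #W) ^ s ≤ M * (M * M ^ (a + j)) ^ s := by gcongr
    _ = M ^ ((j + 1) * s + 1) * (M ^ a) ^ s := by ring

/-! ### Expectations over random subsets. -/

/-- The expectation of `f S`, for a random subset `S` of `U` that contains each `v ∈ U`
independently with probability `p v`. -/
noncomputable def expect (p : V → ℝ) (U : Finset V) (f : Finset V → ℝ) : ℝ :=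
  ∑ S ∈ U.powerset, ((∏ v ∈ S, p v) * ∏ v ∈ U \ S, (1 - p v)) * f S

/-- The indicator of a proposition. -/
noncomputable def ind (P : Prop) : ℝ := if P then 1 else 0

lemma ind_nonneg (P : Prop) : 0 ≤ ind P := by unfold ind; split_ifs <;> norm_num

lemma ind_of {P : Prop} (h : P) : ind P = 1 := if_pos h

lemma ind_of_not {P : Prop} (h : ¬ P) : ind P = 0 := if_neg h

lemma ind_mul (P Q : Prop) : ind P * ind Q = ind (P ∧ Q) := by
  unfold ind
  by_cases hP : P <;> by_cases hQ : Q <;> simp [hP, hQ]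

lemma ind_mono {P Q : Prop} (h : P → Q) : ind P ≤ ind Q := by
  by_cases hP : P
  · rw [ind_of hP, ind_of (h hP)]
  · rw [ind_of_not hP]; exact ind_nonneg _

lemma card_filter_eq_sum_ind (S : Finset V) (P : V → Prop) [DecidablePred P] :
    (#{v ∈ S | P v} : ℝ) = ∑ v ∈ S, ind (P v) := by
  rw [card_filter]
  push_cast
  refine sum_congr rfl fun v _ => ?_
  unfold ind
  split_ifs <;> rfl

section Expect

variable {p : V → ℝ} {U : Finset V}

lemma expect_sub (f g : Finset V → ℝ) :
    expect p U (fun S => f S - g S) = expect p U f - expect p U g := by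
  simp only [expect, mul_sub, sum_sub_distrib]

lemma expect_const_mul (c : ℝ) (f : Finset V → ℝ) :
    expect p U (fun S => c * f S) = c * expect p U f := by
  simp only [expect, mul_sum]
  exact sum_congr rfl fun _ _ => by ring

lemma expect_sum {ι : Type*} (t : Finset ι) (f : ι → Finset V → ℝ) :
    expect p U (fun S => ∑ i ∈ t, f i S) = ∑ i ∈ t, expect p U (f i) := by
  simp only [expect, mul_sum]
  exact sum_comm

lemma expect_mono (hp : ∀ v ∈ U, 0 ≤ p v ∧ p v ≤ 1) {f g : Finset V → ℝ}
    (h : ∀ S ⊆ U, f S ≤ g S) : expect p U f ≤ expect p U g := by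
  refine sum_le_sum fun S hS => mul_le_mul_of_nonneg_left (h S (mem_powerset.1 hS)) ?_
  refine mul_nonneg (prod_nonneg fun v hv => (hp v (mem_powerset.1 hS hv)).1)
    (prod_nonneg fun v hv => ?_)
  have := (hp v (mem_sdiff.1 hv).1).2
  linarith

/-- Expanding `∏ v ∈ U, (p v * [v ∉ J] + (1 - p v) * [v ∉ T])` over subsets leaves exactly the `S`
containing `T` and missing `J`. The factor is `p v` on `T`, `1 - p v` on `J` and `1` elsewhere. -/
lemma expect_ind_subset_disjoint {T J : Finset V} (hT : T ⊆ U) (hJ : J ⊆ U) (hTJ : Disjoint T J) :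
    expect p U (fun S => ind (T ⊆ S ∧ Disjoint J S)) = (∏ v ∈ T, p v) * ∏ v ∈ J, (1 - p v) := by
  have key := Finset.prod_add (fun v => p v * ind (v ∉ J)) (fun v => (1 - p v) * ind (v ∉ T)) U
  have h1 : ∏ v ∈ U, (p v * ind (v ∉ J) + (1 - p v) * ind (v ∉ T))
      = (∏ v ∈ T, p v) * ∏ v ∈ J, (1 - p v) := by
    have hU : U = (T ∪ J) ∪ (U \ (T ∪ J)) := (union_sdiff_of_subset (union_subset hT hJ)).symm
    rw [hU, prod_union disjoint_sdiff, prod_union hTJ]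
    have e1 : ∏ v ∈ T, (p v * ind (v ∉ J) + (1 - p v) * ind (v ∉ T)) = ∏ v ∈ T, p v := by
      refine prod_congr rfl fun v hv => ?_
      rw [ind_of (disjoint_left.1 hTJ hv), ind_of_not (not_not.2 hv)]; ring
    have e2 : ∏ v ∈ J, (p v * ind (v ∉ J) + (1 - p v) * ind (v ∉ T)) = ∏ v ∈ J, (1 - p v) := by
      refine prod_congr rfl fun v hv => ?_
      rw [ind_of (disjoint_right.1 hTJ hv), ind_of_not (not_not.2 hv)]; ring
    have e3 : ∏ v ∈ U \ (T ∪ J), (p v * ind (v ∉ J) + (1 - p v) * ind (v ∉ T)) = 1 := by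
      refine prod_eq_one fun v hv => ?_
      simp only [mem_sdiff, mem_union, not_or] at hv
      rw [ind_of hv.2.1, ind_of hv.2.2]; ring
    rw [e1, e2, e3, mul_one]
  rw [← h1, key, expect]
  refine sum_congr rfl fun S hS => ?_
  rw [prod_mul_distrib, prod_mul_distrib]
  have hSU := mem_powerset.1 hS
  have e1 : ∏ v ∈ S, ind (v ∉ J) = ind (Disjoint J S) := by
    by_cases hd : Disjoint J S
    · rw [ind_of hd]
      exact prod_eq_one fun v hv => ind_of (disjoint_right.1 hd hv)
    · rw [ind_of_not hd]
      obtain ⟨v, hv, hv'⟩ := not_disjoint_iff.1 hd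
      exact prod_eq_zero hv' (ind_of_not (not_not.2 hv))
  have e2 : ∏ v ∈ U \ S, ind (v ∉ T) = ind (T ⊆ S) := by
    by_cases hd : T ⊆ S
    · rw [ind_of hd]
      exact prod_eq_one fun v hv => ind_of fun hc => (mem_sdiff.1 hv).2 (hd hc)
    · rw [ind_of_not hd]
      obtain ⟨v, hv, hv'⟩ := not_subset.1 hd
      exact prod_eq_zero (mem_sdiff.2 ⟨hT hv, hv'⟩) (ind_of_not (not_not.2 hv))
  rw [e1, e2, ← ind_mul]
  ring

lemma expect_ind_subset {T : Finset V} (hT : T ⊆ U) :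
    expect p U (fun S => ind (T ⊆ S)) = ∏ v ∈ T, p v := by
  simpa using expect_ind_subset_disjoint (p := p) hT (empty_subset U) (disjoint_empty_right T)

lemma expect_ind_mem {v : V} (hv : v ∈ U) : expect p U (fun S => ind (v ∈ S)) = p v := by
  simpa using expect_ind_subset (p := p) (singleton_subset_iff.2 hv)

lemma exists_pos_of_expect_pos (hp : ∀ v ∈ U, 0 ≤ p v ∧ p v ≤ 1) {f : Finset V → ℝ}
    (h : 0 < expect p U f) : ∃ S ⊆ U, 0 < f S := by
  by_contra! hc
  have h1 := expect_mono (p := p) hp (g := fun _ => (0 : ℝ)) hc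
  have h2 : expect p U (fun _ => (0 : ℝ)) = 0 := by simp [expect]
  linarith

lemma expect_card (A : Finset V) (hA : A ⊆ U) :
    expect p U (fun S => (#{v ∈ A | v ∈ S} : ℝ)) = ∑ v ∈ A, p v := by
  simp only [card_filter_eq_sum_ind]
  rw [expect_sum]
  exact sum_congr rfl fun v hv => expect_ind_mem (hA hv)

end Expect

/-! ### Graphs of nearly bounded degree ratio. -/

/-- The `4`-cycles through `v` in `H`, recorded as the opposite vertex and the two neighbours. -/
noncomputable def quads (G : SimpleGraph V) (H : Finset V) (v : V) : Finset (Σ _ : V, V × V) :=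
  {t ∈ H.sigma fun x => nb G (nb G H v) x ×ˢ nb G (nb G H v) x | t.1 ≠ v ∧ t.2.1 ≠ t.2.2}

lemma mem_quads {H : Finset V} {v x u w : V} :
    (⟨x, (u, w)⟩ : Σ _ : V, V × V) ∈ quads G H v ↔
      x ∈ H ∧ u ∈ H ∧ w ∈ H ∧ G.Adj v u ∧ G.Adj v w ∧ G.Adj x u ∧ G.Adj x w ∧ x ≠ v ∧ u ≠ w := by
  simp only [quads, mem_filter, mem_sigma, mem_product, mem_nb]
  tauto

/-- A vertex of a graph of bounded degree without large bicliques lies in few `4`-cycles. -/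
lemma card_quads_le {s M f j : ℕ} (hK : BicliqueFree G s) (hM : 2 ≤ M) (hs : s ≤ M)
    (hf : 2 * s ≤ M ^ f) (hj : (j + 1) * s + 1 ≤ f) {H : Finset V}
    (hT : ∀ v ∈ H, #(nb G H v) ≤ M ^ (f + j)) {v : V} (hv : v ∈ H) :
    #(quads G H v) ≤ 2 * (M ^ (f + j)) ^ 2 * M ^ f := by
  set T := M ^ (f + j) with hTdef
  set C : V → Finset V := fun x => nb G (nb G H v) x with hC
  have hCT : ∀ x, #(C x) ≤ T := fun x => (card_le_card (nb_subset _ _)).trans (hT v hv)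
  have h1 : #(quads G H v) ≤ ∑ x ∈ H, #(C x) * #(C x) := by
    refine (card_filter_le _ _).trans ?_
    rw [card_sigma]
    exact (sum_le_sum fun x _ => by rw [card_product])
  have h2 : ∑ x ∈ H, #(C x) ≤ T * T := by
    simp only [hC]
    rw [sum_card_nb_comm]
    calc ∑ b ∈ nb G H v, #(nb G H b) ≤ ∑ _b ∈ nb G H v, T :=
          sum_le_sum fun b hb => hT b (nb_subset _ _ hb)
      _ = #(nb G H v) * T := by rw [sum_const, smul_eq_mul]
      _ ≤ T * T := Nat.mul_le_mul_right _ (hT v hv)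
  -- Opposite vertices of codegree at least `M ^ f` are few by the biclique bound; for the others
  -- one codegree factor is below `M ^ f` and the codegrees sum to at most `T * T`.
  set X := {x ∈ H | M ^ f ≤ #(C x)} with hX
  have h3 : #X ≤ M ^ f := by
    refine (hK.card_le_pow (a := f) (j := j) (nb G H v) X hM hs hf (hT v hv) ?_).trans
      (Nat.pow_le_pow_right (by omega) hj)
    intro x hx
    exact (mem_filter.1 hx).2
  have h4 : ∀ x ∈ H, #(C x) * #(C x) ≤ M ^ f * #(C x) + if M ^ f ≤ #(C x) then T * T else 0 := by
    intro x _
    split_ifs with hc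
    · exact (Nat.mul_le_mul (hCT x) (hCT x)).trans (Nat.le_add_left _ _)
    · exact (Nat.mul_le_mul_right _ (not_le.1 hc).le).trans (Nat.le_add_right _ _)
  calc #(quads G H v) ≤ ∑ x ∈ H, #(C x) * #(C x) := h1
    _ ≤ ∑ x ∈ H, (M ^ f * #(C x) + if M ^ f ≤ #(C x) then T * T else 0) := sum_le_sum h4
    _ = M ^ f * ∑ x ∈ H, #(C x) + #X * (T * T) := by
        rw [sum_add_distrib, ← mul_sum, ← sum_filter, sum_const, smul_eq_mul]
    _ ≤ M ^ f * (T * T) + M ^ f * (T * T) := by gcongr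
    _ = 2 * T ^ 2 * M ^ f := by ring

/-- Deleting a set of vertices loses at most twice the sum of their degrees. -/
lemma degSum_le_of_subset {S S' : Finset V} (h : S' ⊆ S) :
    degSum G S ≤ degSum G S' + 2 * ∑ a ∈ S \ S', #(nb G S a) := by
  have hd : Disjoint (S \ S') S' := sdiff_disjoint
  have hS : S = S \ S' ∪ S' := (sdiff_union_of_subset h).symm
  have h1 := degSum_union (G := G) hd
  rw [← hS] at h1
  have h2 : ∑ a ∈ S \ S', #(nb G S a) = degSum G (S \ S') + ∑ a ∈ S \ S', #(nb G S' a) := by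
    rw [degSum, ← sum_add_distrib]
    refine sum_congr rfl fun a _ => ?_
    rw [← card_nb_union hd, ← hS]
  omega

/-- A new vertex `y` costs one more factor `p`, and at most `n` choices of `y` lie in `Q` already.
This prices the degree lost when a vertex of the configuration `Q` is deleted. -/
lemma sum_pow_card_insert_le {p : ℝ} (hp0 : 0 ≤ p) (Y : Finset V) {D n : ℕ}
    (Q : Finset V) (hQ : #Q = n) (hY : #Y ≤ D) :
    ∑ y ∈ Y, p ^ #(insert y Q) ≤ D * p ^ (n + 1) + n * p ^ n := by
  have h1 : ∀ y ∈ Y, p ^ #(insert y Q) ≤ p ^ (n + 1) + if y ∈ Q then p ^ n else 0 := by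
    intro y _
    split_ifs with hy
    · rw [insert_eq_of_mem hy, hQ]
      have := pow_nonneg hp0 (n + 1)
      linarith
    · rw [card_insert_of_notMem hy, hQ, add_zero]
  refine (sum_le_sum h1).trans ?_
  rw [sum_add_distrib, sum_const, nsmul_eq_mul, ← sum_filter, sum_const, nsmul_eq_mul]
  have h2 : #{y ∈ Y | y ∈ Q} ≤ n := by
    rw [← hQ]
    exact card_le_card fun y hy => (mem_filter.1 hy).2
  have h3 : (#{y ∈ Y | y ∈ Q} : ℝ) ≤ n := by exact_mod_cast h2
  have h4 : (#Y : ℝ) ≤ D := by exact_mod_cast hY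
  have := pow_nonneg hp0 n
  have := pow_nonneg hp0 (n + 1)
  gcongr

/-- A dense set of not too large maximum degree contains a dense `C₄`-free set. -/
theorem hasDenseC4Free_of_degree_le {s k M b c f : ℕ} (hK : BicliqueFree G s) (hs : s ≤ M)
    (hkM : k + 32 ≤ M) (hf : 2 * s ≤ M ^ f) (hfb : f ≤ b + c)
    (hj : (b + c - f + 1) * s + 1 ≤ f) (hcb : f + 3 * c ≤ b) {H : Finset V} (hH : H.Nonempty)
    (hT : ∀ v ∈ H, #(nb G H v) ≤ M ^ (b + c)) (hd : 2 * M ^ (b + 1) * #H ≤ degSum G H) :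
    HasDenseC4Free G k := by
  have hM0 : 0 < M := by omega
  have hMR : (0 : ℝ) < M := by exact_mod_cast hM0
  have hM1 : (1 : ℝ) ≤ M := by exact_mod_cast hM0
  set T := M ^ (b + c) with hTdef
  have hfj : f + (b + c - f) = b + c := by omega
  have hquad : ∀ v ∈ H, #(quads G H v) ≤ 2 * T ^ 2 * M ^ f := by
    intro v hv
    have := card_quads_le (f := f) (j := b + c - f) hK (by omega) hs hf hj (H := H)
      (by rw [hfj]; exact hT) hv
    rwa [hfj] at this
  -- At this rate the expected degree sum is at least `2 * M` times the expected number `#H * p` of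
  -- vertices, whereas deletions cost at most `20` times that number.
  set p : ℝ := ((M : ℝ) ^ b)⁻¹ with hp
  have hp0 : 0 < p := by positivity
  have hp1 : p ≤ 1 := inv_le_one_of_one_le₀ (one_le_pow₀ hM1)
  have hpU : ∀ v ∈ H, 0 ≤ (fun _ : V => p) v ∧ (fun _ : V => p) v ≤ 1 := fun _ _ => ⟨hp0.le, hp1⟩
  let bad : Finset V → V → Prop := fun S v => ∃ t ∈ quads G H v, insert v {t.2.1, t.1, t.2.2} ⊆ S
  -- Degree sum of `S`, minus twice the degrees of the vertices to be deleted (overcounted, once for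
  -- each 4-cycle), minus `k * #S`.
  let Φ : Finset V → ℝ := fun S =>
    (∑ v ∈ H, ∑ y ∈ nb G H v, ind (insert y {v} ⊆ S)) -
    2 * (∑ v ∈ H, ∑ t ∈ quads G H v, ∑ y ∈ nb G H v,
      ind (insert y (insert v {t.2.1, t.1, t.2.2}) ⊆ S)) -
    k * ∑ v ∈ H, ind (v ∈ S)
  have hE : 0 < expect (fun _ => p) H Φ := by
    have e1 : expect (fun _ => p) H (fun S => ∑ v ∈ H, ∑ y ∈ nb G H v, ind (insert y {v} ⊆ S))
        = degSum G H * p ^ 2 := by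
      rw [expect_sum, degSum]
      push_cast
      rw [sum_mul]
      refine sum_congr rfl fun v hv => ?_
      rw [expect_sum, ← nsmul_eq_mul, ← sum_const]
      refine sum_congr rfl fun y hy => ?_
      have hy' := mem_nb.1 hy
      rw [expect_ind_subset (insert_subset hy'.1 (singleton_subset_iff.2 hv)), prod_const,
        card_pair hy'.2.ne']
    have e2 : expect (fun _ => p) H (fun S => ∑ v ∈ H, ∑ t ∈ quads G H v, ∑ y ∈ nb G H v,
        ind (insert y (insert v {t.2.1, t.1, t.2.2}) ⊆ S))
        ≤ #H * ((2 * T ^ 2 * M ^ f : ℕ) * (T * p ^ 5 + 4 * p ^ 4)) := by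
      rw [expect_sum, ← nsmul_eq_mul, ← sum_const]
      refine sum_le_sum fun v hv => ?_
      rw [expect_sum]
      have hpos : (0 : ℝ) ≤ T * p ^ 5 + 4 * p ^ 4 := by positivity
      refine le_trans ?_ (mul_le_mul_of_nonneg_right (Nat.cast_le.2 (hquad v hv)) hpos)
      rw [← nsmul_eq_mul, ← sum_const]
      refine sum_le_sum fun t ht => ?_
      obtain ⟨x, u, w⟩ := t
      obtain ⟨hx, hu, hw, hvu, hvw, hxu, hxw, hxv, huw⟩ := mem_quads.1 ht
      rw [expect_sum]
      have hcard : #(insert v {u, x, w} : Finset V) = 4 := by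
        rw [card_insert_of_notMem, card_insert_of_notMem, card_insert_of_notMem, card_singleton]
        · simpa using hxw.ne
        · simp [hxu.ne', huw]
        · simp [hvu.ne, hvw.ne, hxv.symm]
      refine le_trans (le_of_eq ?_)
        (sum_pow_card_insert_le hp0.le (nb G H v) (insert v {u, x, w}) hcard (hT v hv))
      refine sum_congr rfl fun y hy => ?_
      rw [expect_ind_subset, prod_const]
      simp [insert_subset_iff, (mem_nb.1 hy).1, hv, hu, hx, hw]
    have e3 : expect (fun _ => p) H (fun S => ∑ v ∈ H, ind (v ∈ S)) = #H * p := by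
      rw [expect_sum, ← nsmul_eq_mul, ← sum_const]
      exact sum_congr rfl fun v hv => expect_ind_mem hv
    have e4 : expect (fun _ => p) H Φ = degSum G H * p ^ 2 -
        2 * expect (fun _ => p) H (fun S => ∑ v ∈ H, ∑ t ∈ quads G H v, ∑ y ∈ nb G H v,
        ind (insert y (insert v {t.2.1, t.1, t.2.2}) ⊆ S)) - k * (#H * p) := by
      simp only [Φ]
      rw [expect_sub, expect_sub, expect_const_mul, expect_const_mul, e1, e3]
    have hHpos : (0 : ℝ) < #H := by exact_mod_cast hH.card_pos
    have hdR : (2 : ℝ) * M ^ (b + 1) * #H ≤ degSum G H := by exact_mod_cast hd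
    have hMp : (M : ℝ) ^ b * p = 1 := mul_inv_cancel₀ (by positivity)
    have f1 : (2 : ℝ) * M * (#H * p) ≤ degSum G H * p ^ 2 := by
      calc (2 : ℝ) * M * (#H * p) = 2 * M * (#H * p) * ((M : ℝ) ^ b * p) := by rw [hMp, mul_one]
        _ = 2 * M ^ (b + 1) * #H * p ^ 2 := by ring
        _ ≤ degSum G H * p ^ 2 := by gcongr
    have f2 : ((2 * T ^ 2 * M ^ f : ℕ) : ℝ) * (T * p ^ 5 + 4 * p ^ 4) ≤ 10 * p := by
      have g1 : ((T : ℕ) : ℝ) * p = M ^ c := by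
        rw [hTdef]; push_cast; rw [pow_add, mul_right_comm, hMp, one_mul]
      -- The hypothesis `f + 3 * c ≤ b` makes 4-cycles with a further edge rare.
      have g2 : (M : ℝ) ^ (f + 3 * c) * p ≤ 1 := by
        rw [← hMp]; gcongr
      have g3 : (M : ℝ) ^ (f + 2 * c) ≤ M ^ (f + 3 * c) := pow_le_pow_right₀ hM1 (by omega)
      calc ((2 * T ^ 2 * M ^ f : ℕ) : ℝ) * (T * p ^ 5 + 4 * p ^ 4)
          = 2 * M ^ f * (T * p) ^ 3 * p ^ 2 + 8 * M ^ f * (T * p) ^ 2 * p ^ 2 := by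
            push_cast; ring
        _ = 2 * (M ^ (f + 3 * c) * p) * p + 8 * (M ^ (f + 2 * c) * p) * p := by rw [g1]; ring
        _ ≤ 2 * 1 * p + 8 * (M ^ (f + 3 * c) * p) * p := by gcongr
        _ ≤ 2 * 1 * p + 8 * 1 * p := by gcongr
        _ = 10 * p := by ring
    have f3 : expect (fun _ => p) H (fun S => ∑ v ∈ H, ∑ t ∈ quads G H v, ∑ y ∈ nb G H v,
        ind (insert y (insert v {t.2.1, t.1, t.2.2}) ⊆ S)) ≤ 10 * (#H * p) := by
      refine e2.trans ?_
      calc #H * (((2 * T ^ 2 * M ^ f : ℕ) : ℝ) * (T * p ^ 5 + 4 * p ^ 4)) ≤ #H * (10 * p) := by gcongr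
        _ = 10 * (#H * p) := by ring
    have hkR : (k : ℝ) + 32 ≤ M := by exact_mod_cast hkM
    rw [e4]
    have hx : 0 < (#H : ℝ) * p := by positivity
    nlinarith
  obtain ⟨S, hS, hpos⟩ := exists_pos_of_expect_pos hpU hE
  set S' := {v ∈ S | ¬ bad S v} with hS'
  have hsub : S' ⊆ S := filter_subset _ _
  have h1 : (degSum G S : ℝ) = ∑ v ∈ H, ∑ y ∈ nb G H v, ind (insert y {v} ⊆ S) := by
    have : ∀ v ∈ H, ∑ y ∈ nb G H v, ind (insert y {v} ⊆ S)
        = if v ∈ S then (#(nb G S v) : ℝ) else 0 := by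
      intro v hv
      split_ifs with hvS
      · have : nb G S v = {y ∈ nb G H v | y ∈ S} := by
          ext y
          simp only [mem_nb, mem_filter]
          constructor
          · rintro ⟨h, h'⟩; exact ⟨⟨hS h, h'⟩, h⟩
          · rintro ⟨⟨_, h'⟩, h⟩; exact ⟨h, h'⟩
        rw [this, card_filter_eq_sum_ind]
        refine sum_congr rfl fun y _ => ?_
        congr 1
        simp [insert_subset_iff, hvS]
      · refine sum_eq_zero fun y _ => ind_of_not fun hc => hvS (hc (by simp))
    rw [sum_congr rfl this, ← sum_filter, degSum]
    push_cast
    congr 1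
    ext v
    simp only [mem_filter]
    exact ⟨fun h => ⟨hS h, h⟩, fun h => h.2⟩
  have h2 : ((∑ a ∈ S \ S', #(nb G S a) : ℕ) : ℝ) ≤ ∑ v ∈ H, ∑ t ∈ quads G H v, ∑ y ∈ nb G H v,
      ind (insert y (insert v {t.2.1, t.1, t.2.2}) ⊆ S) := by
    push_cast
    refine le_trans ?_ (sum_le_sum_of_subset_of_nonneg (sdiff_subset.trans hS : S \ S' ⊆ H)
      fun v _ _ => sum_nonneg fun t _ => sum_nonneg fun y _ => ind_nonneg _)
    refine sum_le_sum fun v hv => ?_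
    simp only [hS', mem_sdiff, mem_filter, not_and, not_not] at hv
    obtain ⟨t, ht, htS⟩ := hv.2 hv.1
    refine le_trans ?_ (single_le_sum (fun t _ => sum_nonneg fun y _ => ind_nonneg _) ht)
    have : ({y ∈ nb G H v | y ∈ S} : Finset V) = nb G S v := by
      ext y
      simp only [mem_nb, mem_filter]
      exact ⟨fun h => ⟨h.2, h.1.2⟩, fun h => ⟨⟨hS h.1, h.2⟩, h.1⟩⟩
    rw [← this, card_filter_eq_sum_ind]
    exact sum_le_sum fun y _ => ind_mono fun hy => insert_subset hy htS
  have h3 : (#S : ℝ) = ∑ v ∈ H, ind (v ∈ S) := by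
    rw [← card_filter_eq_sum_ind]
    congr 2
    ext v
    simp only [mem_filter]
    exact ⟨fun h => ⟨hS h, h⟩, fun h => h.2⟩
  have h4 : (degSum G S : ℝ) ≤ degSum G S' + 2 * (∑ a ∈ S \ S', #(nb G S a) : ℕ) := by
    exact_mod_cast degSum_le_of_subset hsub
  have h5 : (#S' : ℝ) ≤ #S := by exact_mod_cast card_le_card hsub
  have h6 : (k : ℝ) * #S' < degSum G S' := by
    have h7 : 0 < Φ S := hpos
    simp only [Φ] at h7
    rw [← h1, ← h3] at h7
    have : (k : ℝ) * #S' ≤ k * #S := by gcongr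
    linarith
  have h6' : k * #S' < degSum G S' := by exact_mod_cast h6
  refine ⟨S', ?_, ?_, h6'.le⟩
  · rw [nonempty_iff_ne_empty]
    intro hc
    rw [hc] at h6'
    simp [degSum] at h6'
  · intro v hv u hu x hx w hw hvx huw hvu hux hxw hwv
    refine (mem_filter.1 hv).2 ⟨⟨x, (u, w)⟩, ?_, ?_⟩
    · exact mem_quads.2 ⟨hS (hsub hx), hS (hsub hu), hS (hsub hw), hvu, hwv.symm, hux.symm, hxw,
        hvx.symm, huw⟩
    · simp [insert_subset_iff, hsub hv, hsub hu, hsub hx, hsub hw]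

/-! ### Sampling in unbalanced bipartite graphs with few heavy pairs. -/

lemma le_degSum_union {A B : Finset V} (h : Disjoint A B) :
    ∑ a ∈ A, #(nb G B a) ≤ degSum G (A ∪ B) := by
  rw [degSum_union h]
  omega

set_option maxHeartbeats 400000 in
/-- Sampling in a bipartite graph: `L u` lists the vertices that have many common neighbours
with `u`, and all other pairs have at most `h` common neighbours. -/
lemma hasDenseC4Free_of_light_pairs {k M e h : ℕ} {A B : Finset V} {L : V → Finset V}
    (hAB : Disjoint A B) (hA : Indep G A) (hB : Indep G B) (hne : A.Nonempty)
    (hkM : 2 * k + 10 ≤ M) (he : 1 ≤ e) (hh : 0 < h)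
    (hlo : ∀ a ∈ A, M ^ e ≤ #(nb G B a)) (hhi : ∀ a ∈ A, #(nb G B a) ≤ M ^ (e + 1))
    (hL : ∀ u, L u ⊆ B) (hLu : ∀ u, u ∉ L u)
    (hheavy : M ^ 5 * ∑ a ∈ A, ∑ u ∈ nb G B a, #(nb G (L u) a) ≤ 2 * M ^ (2 * e) * #A)
    (hlight : ∀ u ∈ B, ∀ w ∈ B, w ≠ u → w ∉ L u → #(nb G (nb G A u) w) ≤ h)
    (hcard : h * M ^ 8 * #B ≤ M ^ e * #A) : HasDenseC4Free G k := by
  have hM0 : 0 < M := by omega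
  have hMR : (0 : ℝ) < M := by exact_mod_cast hM0
  have hM1 : (1 : ℝ) ≤ M := by exact_mod_cast hM0
  have hhR : (1 : ℝ) ≤ h := by exact_mod_cast hh
  set D : ℝ := (M : ℝ) ^ e with hD
  have hD0 : 0 < D := by positivity
  have hMD : (M : ℝ) ≤ D := by
    calc (M : ℝ) = M ^ 1 := (pow_one _).symm
      _ ≤ M ^ e := pow_le_pow_right₀ hM1 he
  -- The rate `β` leaves each vertex of `A` between `M` and `M ^ 2` expected neighbours; `α` makes
  -- the at most `h` further common neighbours of a light pair negligible.
  set β : ℝ := M / D with hβ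
  set α : ℝ := (h * (M : ℝ) ^ 7)⁻¹ with hα
  have hβ0 : 0 < β := by positivity
  have hβ1 : β ≤ 1 := (div_le_one hD0).2 hMD
  have hα0 : 0 < α := by positivity
  have hα1 : α ≤ 1 := inv_le_one_of_one_le₀ (one_le_mul_of_one_le_of_one_le hhR (one_le_pow₀ hM1))
  set p : V → ℝ := fun v => if v ∈ A then α else β with hp
  set U := A ∪ B with hU
  have hpA : ∀ a ∈ A, p a = α := fun a ha => if_pos ha
  have hpB : ∀ b ∈ B, p b = β := fun b hb => if_neg (disjoint_right.1 hAB hb)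
  have hAU : A ⊆ U := subset_union_left
  have hBU : B ⊆ U := subset_union_right
  have hpU : ∀ v ∈ U, 0 ≤ p v ∧ p v ≤ 1 := by
    intro v _
    simp only [hp]
    split_ifs
    · exact ⟨hα0.le, hα1⟩
    · exact ⟨hβ0.le, hβ1⟩
  have hprod : ∀ Q ⊆ B, ∏ v ∈ Q, p v = β ^ #Q := fun Q hQ => by
    rw [prod_congr rfl fun v hv => hpB v (hQ hv), prod_const]
  have hprodA : ∀ Q ⊆ B, ∀ a ∈ A, expect p U (fun S => ind (insert a Q ⊆ S)) = α * β ^ #Q := by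
    intro Q hQ a ha
    rw [expect_ind_subset (insert_subset (hAU ha) (hQ.trans hBU)),
      prod_insert (fun hc => disjoint_left.1 hAB ha (hQ hc)), hprod Q hQ, hpA a ha]
  have hprodAA : ∀ Q ⊆ B, ∀ a ∈ A, ∀ a' ∈ A, a' ≠ a →
      expect p U (fun S => ind (insert a' (insert a Q) ⊆ S)) = α * (α * β ^ #Q) := by
    intro Q hQ a ha a' ha' hne
    rw [expect_ind_subset (insert_subset (hAU ha') (insert_subset (hAU ha) (hQ.trans hBU))),
      prod_insert, prod_insert (fun hc => disjoint_left.1 hAB ha (hQ hc)), hprod Q hQ, hpA a ha,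
      hpA a' ha']
    rw [mem_insert, not_or]
    exact ⟨hne, fun hc => disjoint_left.1 hAB ha' (hQ hc)⟩
  set Lt : V → V → Finset V := fun a u => nb G (B \ insert u (L u)) a with hLt
  -- `X1` counts sampled edges. `X2` and `X3` charge a sampled `a` its sampled degree for each heavy
  -- pair of sampled neighbours, respectively for each light pair with another sampled common
  -- neighbour. `X4` and `X5` count sampled vertices.
  let X1 : Finset V → ℝ := fun S => ∑ a ∈ A, ∑ y ∈ nb G B a, ind (insert a {y} ⊆ S)
  let X2 : Finset V → ℝ := fun S => ∑ a ∈ A, ∑ u ∈ nb G B a, ∑ w ∈ nb G (L u) a,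
    ∑ y ∈ nb G B a, ind (insert a (insert y {u, w}) ⊆ S)
  let X3 : Finset V → ℝ := fun S => ∑ a ∈ A, ∑ u ∈ nb G B a, ∑ w ∈ Lt a u,
    ∑ a' ∈ (nb G (nb G A u) w).erase a, ∑ y ∈ nb G B a,
      ind (insert a' (insert a (insert y {u, w})) ⊆ S)
  let X4 : Finset V → ℝ := fun S => ∑ a ∈ A, ind (a ∈ S)
  let X5 : Finset V → ℝ := fun S => ∑ b ∈ B, ind (b ∈ S)
  let Φ : Finset V → ℝ := fun S => X1 S - X2 S - X3 S - k * X4 S - k * X5 S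
  have hcube : ∀ a ∈ A, ∀ u ∈ nb G B a, ∀ w ∈ nb G B a, u ≠ w →
      ∑ y ∈ nb G B a, β ^ #(insert y {u, w} : Finset V) ≤ 3 * M ^ 4 / D ^ 2 := by
    intro a ha u hu w hw huw
    refine (sum_pow_card_insert_le hβ0.le (nb G B a) {u, w} (card_pair huw) (hhi a ha)).trans ?_
    have : ((M ^ (e + 1) : ℕ) : ℝ) = M * D := by push_cast; rw [hD]; ring
    rw [this, hβ, div_pow, div_pow]
    have h2 : (M : ℝ) ^ 2 ≤ M ^ 4 := pow_le_pow_right₀ hM1 (by norm_num)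
    have h3 : (M : ℝ) * D * (M ^ (2 + 1) / D ^ (2 + 1)) = M ^ 4 / D ^ 2 := by
      field_simp
      ring
    rw [h3, ← mul_div_assoc, ← add_div]
    gcongr
    push_cast
    linarith
  have hhi' : ∀ a ∈ A, (#(nb G B a) : ℝ) ≤ M * D := fun a ha => by
    have : (#(nb G B a) : ℝ) ≤ (M ^ (e + 1) : ℕ) := by exact_mod_cast hhi a ha
    refine this.trans (le_of_eq ?_)
    push_cast; rw [hD]; ring
  have hE : 0 < expect p U Φ := by
    have e1 : #A * (α * M) ≤ expect p U X1 := by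
      simp only [X1]
      rw [expect_sum, ← nsmul_eq_mul, ← sum_const]
      refine sum_le_sum fun a ha => ?_
      rw [expect_sum, sum_congr rfl fun y hy =>
        hprodA {y} (singleton_subset_iff.2 (nb_subset _ _ hy)) a ha]
      simp only [card_singleton, pow_one, sum_const, nsmul_eq_mul]
      have h1 : D ≤ #(nb G B a) := by rw [hD]; exact_mod_cast hlo a ha
      calc α * M = D * (α * β) := by rw [hβ]; field_simp
        _ ≤ _ := by gcongr
    have hBs : ∀ a, ∀ y ∈ nb G B a, ∀ u ∈ nb G B a, ∀ w ∈ nb G B a,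
        (insert y {u, w} : Finset V) ⊆ B := by
      intro a y hy u hu w hw
      simp [insert_subset_iff, (mem_nb.1 hy).1, (mem_nb.1 hu).1, (mem_nb.1 hw).1]
    have e2 : expect p U X2 ≤ #A * α * 6 := by
      have h1 : expect p U X2 ≤
          ∑ a ∈ A, ∑ u ∈ nb G B a, ∑ _w ∈ nb G (L u) a, α * (3 * M ^ 4 / D ^ 2) := by
        simp only [X2]
        rw [expect_sum]
        refine sum_le_sum fun a ha => ?_
        rw [expect_sum]
        refine sum_le_sum fun u hu => ?_
        rw [expect_sum]
        refine sum_le_sum fun w hw => ?_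
        have hw' : w ∈ nb G B a := nb_mono (hL u) a hw
        have huw : u ≠ w := by rintro rfl; exact hLu u (nb_subset _ _ hw)
        rw [expect_sum, sum_congr rfl fun y hy => hprodA _ (hBs a y hy u hu w hw') a ha, ← mul_sum]
        exact mul_le_mul_of_nonneg_left (hcube a ha u hu w hw' huw) hα0.le
      have h2 : (M : ℝ) ^ 5 * ∑ a ∈ A, ∑ u ∈ nb G B a, (#(nb G (L u) a) : ℝ) ≤ 2 * D ^ 2 * #A := by
        have : (2 : ℝ) * D ^ 2 * #A = (2 * M ^ (2 * e) * #A : ℕ) := by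
          push_cast; rw [hD]; ring
        rw [this]
        exact_mod_cast hheavy
      refine h1.trans ?_
      simp only [sum_const, nsmul_eq_mul, ← sum_mul]
      set Q₀ := ∑ a ∈ A, ∑ u ∈ nb G B a, (#(nb G (L u) a) : ℝ) with hQ
      have h3 : (M : ℝ) ^ 4 * Q₀ ≤ M ^ 5 * Q₀ := by
        have : 0 ≤ Q₀ := sum_nonneg fun a _ => sum_nonneg fun u _ => Nat.cast_nonneg _
        exact mul_le_mul_of_nonneg_right (pow_le_pow_right₀ hM1 (by norm_num)) this
      calc Q₀ * (α * (3 * M ^ 4 / D ^ 2)) = (M ^ 4 * Q₀) * (3 * α / D ^ 2) := by ring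
        _ ≤ (2 * D ^ 2 * #A) * (3 * α / D ^ 2) := by
            exact mul_le_mul_of_nonneg_right (h3.trans h2) (by positivity)
        _ = #A * α * 6 := by field_simp; ring
    have e3 : expect p U X3 ≤ #A * α * 3 := by
      have h1 : expect p U X3 ≤ ∑ a ∈ A, ∑ u ∈ nb G B a, ∑ w ∈ Lt a u,
          h * (α * (α * (3 * M ^ 4 / D ^ 2))) := by
        simp only [X3]
        rw [expect_sum]
        refine sum_le_sum fun a ha => ?_
        rw [expect_sum]
        refine sum_le_sum fun u hu => ?_
        rw [expect_sum]
        refine sum_le_sum fun w hw => ?_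
        have hw0 := mem_nb.1 hw
        rw [mem_sdiff, mem_insert, not_or] at hw0
        have hw' : w ∈ nb G B a := mem_nb.2 ⟨hw0.1.1, hw0.2⟩
        have huw : u ≠ w := fun hc => hw0.1.2.1 hc.symm
        have hc0 : #((nb G (nb G A u) w).erase a) ≤ h := (card_erase_le).trans
          (hlight u (nb_subset _ _ hu) w hw0.1.1 hw0.1.2.1 hw0.1.2.2)
        have hc : (#((nb G (nb G A u) w).erase a) : ℝ) ≤ h := by exact_mod_cast hc0
        have h0 : 0 ≤ α * (α * (3 * (M : ℝ) ^ 4 / D ^ 2)) := by positivity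
        rw [expect_sum]
        refine le_trans ?_ (mul_le_mul_of_nonneg_right hc h0)
        rw [← nsmul_eq_mul, ← sum_const]
        refine sum_le_sum fun a' ha' => ?_
        have ha'' := mem_erase.1 ha'
        have haA : a' ∈ A := nb_subset _ _ (nb_subset _ _ ha''.2)
        rw [expect_sum, sum_congr rfl fun y hy =>
          hprodAA _ (hBs a y hy u hu w hw') a ha a' haA ha''.1, ← mul_sum, ← mul_sum]
        have := hcube a ha u hu w hw' huw
        gcongr
      refine h1.trans ?_
      have h2 : ∀ a ∈ A, ∑ u ∈ nb G B a, ∑ w ∈ Lt a u, h * (α * (α * (3 * (M : ℝ) ^ 4 / D ^ 2)))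
          ≤ (M * D) * ((M * D) * (h * (α * (α * (3 * (M : ℝ) ^ 4 / D ^ 2))))) := by
        intro a ha
        have h0 : 0 ≤ h * (α * (α * (3 * (M : ℝ) ^ 4 / D ^ 2))) := by positivity
        refine le_trans (sum_le_card_nsmul _ _ _ fun u hu => ?_)
          ((nsmul_eq_mul _ _).trans_le (mul_le_mul_of_nonneg_right (hhi' a ha) (by positivity)))
        rw [sum_const, nsmul_eq_mul]
        have h3 : (#(Lt a u) : ℝ) ≤ #(nb G B a) := by
          exact_mod_cast card_nb_mono sdiff_subset a
        exact mul_le_mul_of_nonneg_right (h3.trans (hhi' a ha)) h0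
      refine (sum_le_sum h2).trans ?_
      rw [sum_const, nsmul_eq_mul]
      have h4 : (M : ℝ) * D * ((M * D) * (h * (α * (α * (3 * (M : ℝ) ^ 4 / D ^ 2)))))
          = 3 * α / M := by
        rw [hα]; field_simp
      rw [h4, mul_assoc]
      gcongr
      calc 3 * α / M ≤ 3 * α / 1 := by gcongr
        _ = α * 3 := by ring
    have e4 : expect p U X4 = #A * α := by
      simp only [X4]
      rw [expect_sum, ← nsmul_eq_mul, ← sum_const]
      exact sum_congr rfl fun v hv => (expect_ind_mem (hAU hv)).trans (hpA v hv)
    have e5 : expect p U X5 = #B * β := by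
      simp only [X5]
      rw [expect_sum, ← nsmul_eq_mul, ← sum_const]
      exact sum_congr rfl fun v hv => (expect_ind_mem (hBU hv)).trans (hpB v hv)
    have e6 : expect p U Φ = expect p U X1 - expect p U X2 - expect p U X3 - k * (#A * α)
        - k * (#B * β) := by
      simp only [Φ]
      rw [expect_sub, expect_sub, expect_sub, expect_sub, expect_const_mul, expect_const_mul, e4, e5]
    -- The imbalance keeps the expected sample of `B` no larger than that of `A`, so the vertices
    -- cost at most `2 * k` per sampled vertex of `A`.
    have e7 : #B * β ≤ #A * α := by
      have h1 : (h : ℝ) * M ^ 8 * #B ≤ D * #A := by rw [hD]; exact_mod_cast hcard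
      rw [hβ, hα, ← mul_div_assoc, ← div_eq_mul_inv, div_le_div_iff₀ hD0 (by positivity)]
      calc #B * (M : ℝ) * (h * M ^ 7) = h * M ^ 8 * #B := by ring
        _ ≤ D * #A := h1
        _ = #A * D := mul_comm _ _
    have e8 : (k : ℝ) * (#B * β) ≤ k * (#A * α) := by gcongr
    have hx : 0 < (#A : ℝ) * α := mul_pos (by exact_mod_cast hne.card_pos) hα0
    have hkR : 2 * (k : ℝ) + 10 ≤ M := by exact_mod_cast hkM
    rw [e6]
    nlinarith
  obtain ⟨S, hS, hpos⟩ := exists_pos_of_expect_pos hpU hE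
  have hpos' : 0 < X1 S - X2 S - X3 S - k * X4 S - k * X5 S := hpos
  -- Deletion on the `A` side alone suffices: a sampled 4-cycle makes its vertices in `A` bad.
  let bad : V → Prop := fun a => ∃ u ∈ nb G B a, u ∈ S ∧ ∃ w ∈ nb G B a, w ∈ S ∧ u ≠ w ∧
    (w ∈ L u ∨ ∃ a' ∈ A, a' ∈ S ∧ a' ≠ a ∧ G.Adj a' u ∧ G.Adj a' w)
  set B' := {b ∈ B | b ∈ S} with hB'
  set A0 := {a ∈ A | a ∈ S} with hA0
  set A' := {a ∈ A0 | ¬ bad a} with hA'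
  have hA'A : A' ⊆ A := (filter_subset _ _).trans (filter_subset _ _)
  have hB'B : B' ⊆ B := filter_subset _ _
  have hdisj : Disjoint A' B' := disjoint_of_subset_left hA'A (disjoint_of_subset_right hB'B hAB)
  have hnbS : ∀ a, (#(nb G B' a) : ℝ) = ∑ y ∈ nb G B a, ind (y ∈ S) := by
    intro a
    rw [← card_filter_eq_sum_ind]
    congr 2
    ext y
    simp only [hB', mem_nb, mem_filter]
    tauto
  have hnbS' : ∀ a ∈ S, (#(nb G B' a) : ℝ) = ∑ y ∈ nb G B a, ind (insert a {y} ⊆ S) := by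
    intro a ha
    rw [hnbS]
    refine sum_congr rfl fun y _ => ?_
    congr 1
    simp [insert_subset_iff, ha]
  have h1 : X1 S = ∑ a ∈ A0, (#(nb G B' a) : ℝ) := by
    simp only [X1]
    rw [hA0, sum_filter]
    refine sum_congr rfl fun a _ => ?_
    split_ifs with ha
    · exact (hnbS' a ha).symm
    · exact sum_eq_zero fun y _ => ind_of_not fun hc => ha (hc (by simp))
  have h2 : ∑ a ∈ A0 \ A', (#(nb G B' a) : ℝ) ≤ X2 S + X3 S := by
    simp only [X2, X3]
    rw [← sum_add_distrib]
    refine le_trans ?_ (sum_le_sum_of_subset_of_nonneg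
      (sdiff_subset.trans (filter_subset _ _) : A0 \ A' ⊆ A)
      fun v _ _ => add_nonneg (sum_nonneg fun t _ => sum_nonneg fun y _ => sum_nonneg fun _ _ =>
        ind_nonneg _) (sum_nonneg fun t _ => sum_nonneg fun y _ => sum_nonneg fun _ _ =>
        sum_nonneg fun _ _ => ind_nonneg _))
    refine sum_le_sum fun a ha => ?_
    obtain ⟨ha0, ha1⟩ := mem_sdiff.1 ha
    have haS : a ∈ S := (mem_filter.1 ha0).2
    obtain ⟨u, hu, huS, w, hw, hwS, huw, hcase⟩ : bad a :=
      by_contra fun hc => ha1 (mem_filter.2 ⟨ha0, hc⟩)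
    by_cases hwL : w ∈ L u
    · refine le_trans ?_ (le_add_of_nonneg_right (sum_nonneg fun t _ => sum_nonneg fun y _ =>
        sum_nonneg fun _ _ => sum_nonneg fun _ _ => ind_nonneg _))
      refine le_trans ?_ (single_le_sum (fun t _ => sum_nonneg fun y _ => sum_nonneg fun _ _ =>
        ind_nonneg _) hu)
      refine le_trans ?_ (single_le_sum (fun t _ => sum_nonneg fun y _ =>
        ind_nonneg _) (mem_nb.2 ⟨hwL, (mem_nb.1 hw).2⟩))
      rw [hnbS]
      refine sum_le_sum fun y _ => ind_mono fun hy => ?_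
      simp [insert_subset_iff, haS, hy, huS, hwS]
    · obtain ⟨a', ha'A, ha'S, hne', hau, haw⟩ := hcase.resolve_left hwL
      refine le_trans ?_ (le_add_of_nonneg_left (sum_nonneg fun t _ => sum_nonneg fun y _ =>
        sum_nonneg fun _ _ => ind_nonneg _))
      refine le_trans ?_ (single_le_sum (fun t _ => sum_nonneg fun y _ => sum_nonneg fun _ _ =>
        sum_nonneg fun _ _ => ind_nonneg _) hu)
      have hwLt : w ∈ Lt a u := by
        simp only [hLt, mem_nb, mem_sdiff, mem_insert, not_or]
        exact ⟨⟨(mem_nb.1 hw).1, huw.symm, hwL⟩, (mem_nb.1 hw).2⟩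
      refine le_trans ?_ (single_le_sum (fun t _ => sum_nonneg fun y _ => sum_nonneg fun _ _ =>
        ind_nonneg _) hwLt)
      have ha'm : a' ∈ (nb G (nb G A u) w).erase a := by
        simp only [mem_erase, mem_nb]
        exact ⟨hne', ⟨ha'A, hau.symm⟩, haw.symm⟩
      refine le_trans ?_ (single_le_sum (fun t _ => sum_nonneg fun y _ => ind_nonneg _) ha'm)
      rw [hnbS]
      refine sum_le_sum fun y _ => ind_mono fun hy => ?_
      simp [insert_subset_iff, haS, hy, huS, hwS, ha'S]
  have h3 : ∑ a ∈ A0, (#(nb G B' a) : ℝ)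
      = ∑ a ∈ A0 \ A', (#(nb G B' a) : ℝ) + ∑ a ∈ A', (#(nb G B' a) : ℝ) :=
    (sum_sdiff (filter_subset _ _)).symm
  have h4 : (#A' : ℝ) ≤ X4 S := by
    simp only [X4]
    rw [← card_filter_eq_sum_ind]
    exact_mod_cast card_le_card (filter_subset _ _)
  have h5 : (#B' : ℝ) = X5 S := card_filter_eq_sum_ind _ _
  have h6 : ((∑ a ∈ A', #(nb G B' a) : ℕ) : ℝ) ≤ degSum G (A' ∪ B') := by
    exact_mod_cast le_degSum_union hdisj
  push_cast at h6
  have h7 : (k : ℝ) * #A' ≤ k * X4 S := by gcongr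
  have h8 : (k : ℝ) * (#A' + #B') < degSum G (A' ∪ B') := by
    rw [h5, mul_add]
    linarith
  have h9 : k * #(A' ∪ B') < degSum G (A' ∪ B') := by
    rw [card_union_of_disjoint hdisj]
    exact_mod_cast h8
  have key : ∀ v ∈ A', ∀ x ∈ A', ∀ u ∈ B', ∀ w ∈ B', v ≠ x → u ≠ w → G.Adj v u → G.Adj x u →
      G.Adj x w → G.Adj v w → False := by
    intro v hv x hx u hu w hw hvx huw hvu hxu hxw hvw
    have hu' := mem_filter.1 hu
    have hw' := mem_filter.1 hw
    refine (mem_filter.1 hv).2 ⟨u, mem_nb.2 ⟨hu'.1, hvu⟩, hu'.2, w, mem_nb.2 ⟨hw'.1, hvw⟩, hw'.2,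
      huw, Or.inr ⟨x, hA'A hx, (mem_filter.1 (mem_filter.1 hx).1).2, hvx.symm, hxu, hxw⟩⟩
  refine ⟨A' ∪ B', ?_, ?_, h9.le⟩
  · rw [nonempty_iff_ne_empty]
    intro hc
    rw [hc] at h9
    simp [degSum] at h9
  · have hAi := hA.mono hA'A
    have hBi := hB.mono hB'B
    intro v hv u hu x hx w hw hvx huw hvu hux hxw hwv
    rcases mem_union.1 hv with hv | hv
    · have hu' := (mem_union.1 hu).resolve_left fun h => hAi v hv u h hvu
      have hw' := (mem_union.1 hw).resolve_left fun h => hAi w h v hv hwv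
      have hx' := (mem_union.1 hx).resolve_right fun h => hBi u hu' x h hux
      exact key v hv x hx' u hu' w hw' hvx huw hvu hux.symm hxw hwv.symm
    · have hu' := (mem_union.1 hu).resolve_right fun h => hBi v hv u h hvu
      have hw' := (mem_union.1 hw).resolve_right fun h => hBi w h v hv hwv
      have hx' := (mem_union.1 hx).resolve_left fun h => hAi u hu' x h hux
      exact key u hu' w hw' v hv x hx' huw hvx hvu.symm hwv hxw.symm hux

/-! ### Unbalanced bipartite graphs: induction on the size of the forbidden biclique. -/

/-- One of `n` consecutive ranges of values `[M ^ e, M ^ (e + 1))` is taken often. -/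
lemma exists_large_pow_class {M lo n : ℕ} (hM : 2 ≤ M) {X : Finset V} (f : V → ℕ)
    (hX : X.Nonempty) (hlo : ∀ x ∈ X, M ^ lo ≤ f x) (hhi : ∀ x ∈ X, f x < M ^ (lo + n)) :
    ∃ e, lo ≤ e ∧ e < lo + n ∧ #X ≤ n * #{x ∈ X | M ^ e ≤ f x ∧ f x < M ^ (e + 1)} := by
  have hmaps : ∀ x ∈ X, Nat.log M (f x) ∈ Ico lo (lo + n) := by
    intro x hx
    have h0 : f x ≠ 0 := by
      have := hlo x hx
      have : 0 < M ^ lo := by positivity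
      omega
    rw [mem_Ico]
    exact ⟨Nat.le_log_of_pow_le (by omega) (hlo x hx), Nat.log_lt_of_lt_pow h0 (hhi x hx)⟩
  obtain ⟨x₀, hx₀⟩ := hX
  obtain ⟨e, he, hmax⟩ := exists_max_image (Ico lo (lo + n)) (fun e => #{x ∈ X | Nat.log M (f x) = e})
    ⟨_, hmaps x₀ hx₀⟩
  rw [mem_Ico] at he
  refine ⟨e, he.1, he.2, ?_⟩
  have h1 := card_le_mul_card_image_of_maps_to hmaps _ hmax
  rw [Nat.card_Ico, Nat.add_sub_cancel_left, mul_comm] at h1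
  refine h1.trans (Nat.mul_le_mul_left _ (card_le_card fun x hx => ?_))
  rw [mem_filter] at hx ⊢
  refine ⟨hx.1, ?_, ?_⟩
  · rw [← hx.2]
    refine Nat.pow_log_le_self M ?_
    have := hlo x hx.1
    have : 0 < M ^ lo := by positivity
    omega
  · rw [← hx.2]
    exact Nat.lt_pow_succ_log_self (by omega) _

lemma sum_sum_nb_comm (A B : Finset V) (g : V → V → ℕ) :
    ∑ a ∈ A, ∑ u ∈ nb G B a, g a u = ∑ u ∈ B, ∑ a ∈ nb G A u, g a u := by
  refine sum_comm' fun a u => ?_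
  simp only [mem_nb]
  constructor
  · rintro ⟨h, h', h''⟩; exact ⟨⟨h, h''.symm⟩, h'⟩
  · rintro ⟨⟨h, h''⟩, h'⟩; exact ⟨h, h', h''.symm⟩

/-- A bipartite graph with a much larger side, all of whose degrees there are about equal, and
without bicliques `K_{t,s}`, contains a dense `C₄`-free induced subgraph. -/
theorem hasDenseC4Free_of_bipartite {s k M : ℕ} (hkM : 2 * k + 10 ≤ M) (hsM : s ≤ M) (t : ℕ) :
    ∀ {e : ℕ} {A B : Finset V}, Disjoint A B → Indep G A → Indep G B → A.Nonempty →
      (∀ a ∈ A, M ^ e ≤ #(nb G B a)) → (∀ a ∈ A, #(nb G B a) < M ^ (e + 1)) →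
      (∀ Q ⊆ B, #Q = t → #{a ∈ A | Q ⊆ nb G B a} < s) →
      M ^ (18 * t) * #B ≤ #A → 7 * t + 2 ≤ e → HasDenseC4Free G k := by
  have hM0 : 0 < M := by omega
  induction t with
  | zero =>
    intro e A B _ _ _ hne hlo _ hQ hcard he
    exfalso
    -- The empty `t`-set gives `#A < s ≤ M`, while one degree already forces `M ≤ M ^ e ≤ #B ≤ #A`.
    have h1 := hQ ∅ (empty_subset _) card_empty
    simp only [empty_subset, filter_true] at h1
    obtain ⟨a, ha⟩ := hne
    have h2 := (hlo a ha).trans (card_le_card (nb_subset _ _))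
    have h3 : M ^ 1 ≤ M ^ e := Nat.pow_le_pow_right hM0 (by omega)
    rw [mul_zero, pow_zero, one_mul] at hcard
    rw [pow_one] at h3
    omega
  | succ t ih =>
    intro e A B hAB hA hB hne hlo hhi hQ hcard he
    -- This heaviness threshold serves both branches: `h * M ^ 8 = M ^ e * M ^ (18 * (t + 1))` is
    -- what sampling needs, and restricting to a heavy neighbourhood retains the imbalance `M ^ (18
    -- * t)`.
    set h := M ^ (18 * t + e + 10) with hh
    set F : V → Finset V := fun u => nb G A u with hF
    set L : V → Finset V := fun u => {w ∈ B.erase u | h ≤ #(nb G (F u) w)} with hL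
    set F' : V → Finset V := fun u => {a ∈ F u | M ^ (e - 6) ≤ #(nb G (L u) a)} with hF'
    have hLB : ∀ u, L u ⊆ B := fun u => (filter_subset _ _).trans (erase_subset _ _)
    have hLu : ∀ u, u ∉ L u := fun u hc => by simp [hL] at hc
    by_cases hc : ∃ u ∈ B, (F u).Nonempty ∧ #(F u) ≤ M ^ 8 * #(F' u)
    · obtain ⟨u, hu, hFne, hFF'⟩ := hc
      have hF'ne : (F' u).Nonempty := by
        rw [← card_pos]
        have := hFne.card_pos
        exact Nat.pos_of_ne_zero fun h0 => by rw [h0] at hFF'; omega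
      have hF'A : F' u ⊆ A := (filter_subset _ _).trans (nb_subset _ _)
      -- Degrees into `L u` fall into seven classes, so the exponent `e` drops by at most `6`.
      have he6 : e - 6 + 7 = e + 1 := by omega
      obtain ⟨e', he1, he2, hclass⟩ := exists_large_pow_class (M := M) (lo := e - 6) (n := 7)
        (by omega) (fun a => #(nb G (L u) a)) hF'ne (fun a ha => (mem_filter.1 ha).2)
        (fun a ha => by
          rw [he6]
          exact (card_nb_mono (hLB u) a).trans_lt (hhi a (hF'A ha)))
      set K := {x ∈ F' u | M ^ e' ≤ #(nb G (L u) x) ∧ #(nb G (L u) x) < M ^ (e' + 1)} with hK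
      have hKF' : K ⊆ F' u := filter_subset _ _
      have hKA : K ⊆ A := hKF'.trans hF'A
      have hKF : K ⊆ F u := hKF'.trans (filter_subset _ _)
      have hKne : K.Nonempty := by
        rw [← card_pos]
        have := hF'ne.card_pos
        exact Nat.pos_of_ne_zero fun h0 => by rw [h0] at hclass; omega
      have hFK : #(F u) ≤ M ^ 9 * #K := by
        calc #(F u) ≤ M ^ 8 * (7 * #K) := hFF'.trans (Nat.mul_le_mul_left _ hclass)
          _ ≤ M ^ 8 * (M * #K) := by gcongr; omega
          _ = M ^ 9 * #K := by ring
      have hLcard : #(L u) * h ≤ #(F u) * M ^ (e + 1) := by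
        calc #(L u) * h ≤ ∑ w ∈ L u, #(nb G (F u) w) := by
              rw [← smul_eq_mul]
              exact card_nsmul_le_sum _ _ _ fun w hw => (mem_filter.1 hw).2
          _ = ∑ a ∈ F u, #(nb G (L u) a) := sum_card_nb_comm _ _
          _ ≤ #(F u) • M ^ (e + 1) := sum_le_card_nsmul _ _ _ fun a ha =>
              ((card_nb_mono (hLB u) a).trans_lt (hhi a (nb_subset _ _ ha))).le
          _ = #(F u) * M ^ (e + 1) := smul_eq_mul _ _
      refine ih (disjoint_of_subset_left hKA (disjoint_of_subset_right (hLB u) hAB))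
        (hA.mono hKA) (hB.mono (hLB u)) hKne (fun a ha => (mem_filter.1 ha).2.1)
        (fun a ha => (mem_filter.1 ha).2.2) ?_ ?_ (by omega)
      · intro Q hQL hQt
        -- All of `K` is adjacent to `u`, so the common neighbours in `K` of a `t`-set `Q` are also
        -- common neighbours of the `(t + 1)`-set `insert u Q`.
        have huQ : u ∉ Q := fun hc => hLu u (hQL hc)
        refine lt_of_le_of_lt (card_le_card fun a ha => ?_) (hQ (insert u Q)
          (insert_subset hu (hQL.trans (hLB u))) (by rw [card_insert_of_notMem huQ, hQt]))
        rw [mem_filter] at ha ⊢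
        refine ⟨hKA ha.1, insert_subset ?_ (ha.2.trans (nb_mono (hLB u) a))⟩
        exact mem_nb.2 ⟨hu, (mem_nb.1 (hKF ha.1)).2.symm⟩
      · refine Nat.le_of_mul_le_mul_right (c := M ^ (e + 10)) ?_ (by positivity)
        calc M ^ (18 * t) * #(L u) * M ^ (e + 10) = #(L u) * h := by rw [hh]; ring
          _ ≤ M ^ 9 * #K * M ^ (e + 1) := hLcard.trans (Nat.mul_le_mul_right _ hFK)
          _ = #K * M ^ (e + 10) := by ring
    · push Not at hc
      refine hasDenseC4Free_of_light_pairs (h := h) (e := e) (L := L) hAB hA hB hne hkM (by omega)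
        (by positivity) hlo (fun a ha => (hhi a ha).le) hLB hLu ?_ ?_ ?_
      · have h1 : ∀ u ∈ B, M ^ 7 * ∑ a ∈ F u, #(nb G (L u) a) ≤ #(F u) * (2 * M ^ (e + 1)) := by
          intro u hu
          have hFF' : M ^ 8 * #(F' u) ≤ #(F u) := by
            rcases (F u).eq_empty_or_nonempty with h0 | h0
            · have : F' u = ∅ := by simp only [hF']; rw [h0, filter_empty]
              rw [this, card_empty]; omega
            · exact (hc u hu h0).le
          have h2 : ∀ a ∈ F u, #(nb G (L u) a) ≤ M ^ (e - 6) +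
              if M ^ (e - 6) ≤ #(nb G (L u) a) then M ^ (e + 1) else 0 := by
            intro a ha
            split_ifs with h3
            · have := ((card_nb_mono (hLB u) a).trans_lt (hhi a (nb_subset _ _ ha))).le
              omega
            · omega
          have h3 : ∑ a ∈ F u, #(nb G (L u) a) ≤ #(F u) * M ^ (e - 6) + #(F' u) * M ^ (e + 1) := by
            refine (sum_le_sum h2).trans (le_of_eq ?_)
            rw [sum_add_distrib, ← sum_filter, sum_const, sum_const, smul_eq_mul, smul_eq_mul]
          have he7 : M ^ 7 * M ^ (e - 6) = M ^ (e + 1) := by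
            rw [← pow_add]; congr 1; omega
          calc M ^ 7 * ∑ a ∈ F u, #(nb G (L u) a)
              ≤ M ^ 7 * (#(F u) * M ^ (e - 6) + #(F' u) * M ^ (e + 1)) := Nat.mul_le_mul_left _ h3
            _ = #(F u) * (M ^ 7 * M ^ (e - 6)) + (M ^ 8 * #(F' u)) * M ^ e := by ring
            _ ≤ #(F u) * M ^ (e + 1) + #(F u) * M ^ (e + 1) := by
                rw [he7]
                gcongr
                omega
            _ = _ := by ring
        refine Nat.le_of_mul_le_mul_left (c := M ^ 2) ?_ (by positivity)
        rw [sum_sum_nb_comm]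
        calc M ^ 2 * (M ^ 5 * ∑ u ∈ B, ∑ a ∈ nb G A u, #(nb G (L u) a))
            = ∑ u ∈ B, M ^ 7 * ∑ a ∈ F u, #(nb G (L u) a) := by
              rw [← mul_sum]; ring
          _ ≤ ∑ u ∈ B, #(F u) * (2 * M ^ (e + 1)) := sum_le_sum h1
          _ = (∑ a ∈ A, #(nb G B a)) * (2 * M ^ (e + 1)) := by
              rw [← sum_mul, sum_card_nb_comm]
          _ ≤ (#A • M ^ (e + 1)) * (2 * M ^ (e + 1)) := Nat.mul_le_mul_right _
              (sum_le_card_nsmul _ _ _ fun a ha => (hhi a ha).le)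
          _ = M ^ 2 * (2 * M ^ (2 * e) * #A) := by rw [smul_eq_mul]; ring
      · intro u _ w hw hne' hwL
        by_contra! hlt
        exact hwL (mem_filter.2 ⟨mem_erase.2 ⟨hne', hw⟩, hlt.le⟩)
      · calc h * M ^ 8 * #B = M ^ e * (M ^ (18 * (t + 1)) * #B) := by rw [hh]; ring
          _ ≤ M ^ e * #A := Nat.mul_le_mul_left _ hcard

/-- The reduction of the unbalanced case to `hasDenseC4Free_of_bipartite`. -/
lemma hasDenseC4Free_of_unbalanced {s k M D x n : ℕ} (hK : BicliqueFree G s)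
    (hkM : 2 * k + 10 ≤ M) (hsM : s ≤ M) (hDx : D + 1 ≤ M ^ x) (hnM : n ≤ M) {A X : Finset V}
    (hAX : Disjoint A X) (hne : A.Nonempty) (hA : SparseOn G A D) (hX : Indep G X)
    (hlo : ∀ a ∈ A, M ^ (7 * s + 2) ≤ #(nb G X a))
    (hhi : ∀ a ∈ A, #(nb G X a) < M ^ (7 * s + 2 + n))
    (hcard : M ^ (18 * s + x + 1) * #X ≤ #A) : HasDenseC4Free G k := by
  have hM0 : 0 < M := by omega
  obtain ⟨I, hIA, hI, hAI⟩ := hA.exists_indep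
  have hIne : I.Nonempty := by
    rw [← card_pos]
    have := hne.card_pos
    exact Nat.pos_of_ne_zero fun h0 => by rw [h0] at hAI; omega
  obtain ⟨e, he1, -, hclass⟩ := exists_large_pow_class (M := M) (lo := 7 * s + 2) (n := n)
    (by omega) (fun a => #(nb G X a)) hIne (fun a ha => hlo a (hIA ha)) (fun a ha => hhi a (hIA ha))
  set K := {a ∈ I | M ^ e ≤ #(nb G X a) ∧ #(nb G X a) < M ^ (e + 1)} with hKdef
  have hKI : K ⊆ I := filter_subset _ _
  have hKne : K.Nonempty := by
    rw [← card_pos]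
    have := hIne.card_pos
    exact Nat.pos_of_ne_zero fun h0 => by rw [h0] at hclass; omega
  refine hasDenseC4Free_of_bipartite hkM hsM s (e := e)
    (disjoint_of_subset_left (hKI.trans hIA) hAX) (hI.mono hKI) hX hKne
    (fun a ha => (mem_filter.1 ha).2.1) (fun a ha => (mem_filter.1 ha).2.2) ?_ ?_ he1
  · intro Q hQX hQs
    by_contra! hc
    obtain ⟨R, hR, hRs⟩ := exists_subset_card_eq hc
    refine hK Q R hQs hRs fun q hq r hr => ?_
    have := (mem_filter.1 (hR hr)).2 hq
    exact (mem_nb.1 this).2.symm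
  -- The surplus `M ^ (x + 1)` pays `M ^ x` for the independent set and `M` for choosing one of `n ≤
  -- M` degree classes.
  · refine Nat.le_of_mul_le_mul_left (c := M ^ (x + 1)) ?_ (by positivity)
    calc M ^ (x + 1) * (M ^ (18 * s) * #X) = M ^ (18 * s + x + 1) * #X := by ring
      _ ≤ #A := hcard
      _ ≤ (D + 1) * (n * #K) := hAI.trans (Nat.mul_le_mul_left _ hclass)
      _ ≤ M ^ x * (M * #K) := by gcongr
      _ = M ^ (x + 1) * #K := by ring

/-! ### Random independent sets from orientations. -/

/-- The vertices of `S` that have no out-neighbour in `S`. -/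
noncomputable def core (out : V → Finset V) (S : Finset V) : Finset V :=
  {x ∈ S | Disjoint (out x) S}

lemma mem_core {out : V → Finset V} {S : Finset V} {x : V} :
    x ∈ core out S ↔ x ∈ S ∧ Disjoint (out x) S := by simp [core]

/-- Every edge is oriented in some direction and its tail cannot lie in the core together with its
head, so the core is independent. Comparing expectations, with `#S` as an upper bound for the size
of the core, yields a good sample. -/
lemma exists_indep_of_prob {Y A : Finset V} {out : V → Finset V} {p π l : ℝ} {m : ℕ}
    (hout : ∀ x ∈ Y, ∀ y ∈ Y, G.Adj x y → y ∈ out x ∨ x ∈ out y)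
    (hp0 : 0 ≤ p) (hp1 : p ≤ 1) (hl : 0 ≤ l)
    (hA : ∀ a ∈ A, π ≤ expect (fun _ => p) Y fun S => ind (m ≤ #(nb G (core out S) a)))
    (hlt : l * (p * #Y) < π * #A) :
    ∃ X ⊆ Y, Indep G X ∧ l * #X < #{a ∈ A | m ≤ #(nb G X a)} := by
  have hE : 0 < expect (fun _ => p) Y (fun S => (∑ a ∈ A, ind (m ≤ #(nb G (core out S) a))) -
      l * #{y ∈ Y | y ∈ S}) := by
    rw [expect_sub, expect_const_mul, expect_card Y subset_rfl, expect_sum, sum_const, nsmul_eq_mul]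
    have h1 : #A • π ≤ ∑ a ∈ A, expect (fun _ => p) Y fun S => ind (m ≤ #(nb G (core out S) a)) :=
      card_nsmul_le_sum _ _ _ hA
    rw [nsmul_eq_mul] at h1
    linarith [mul_comm (#Y : ℝ) p, mul_comm (#A : ℝ) π]
  obtain ⟨S, hS, hpos⟩ := exists_pos_of_expect_pos (fun _ _ => ⟨hp0, hp1⟩) hE
  have hcS : core out S ⊆ S := filter_subset _ _
  refine ⟨core out S, hcS.trans hS, ?_, ?_⟩
  · intro u hu v hv huv
    have hu' := mem_core.1 hu
    have hv' := mem_core.1 hv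
    rcases hout u (hS hu'.1) v (hS hv'.1) huv with h | h
    · exact disjoint_left.1 hu'.2 h hv'.1
    · exact disjoint_left.1 hv'.2 h hu'.1
  · rw [card_filter_eq_sum_ind]
    have h1 : (#(core out S) : ℝ) ≤ #{y ∈ Y | y ∈ S} := by
      exact_mod_cast card_le_card fun x hx => mem_filter.2 ⟨hS (hcS hx), hcS hx⟩
    have h2 := mul_le_mul_of_nonneg_left h1 hl
    linarith

lemma one_sub_mul_le_pow {p : ℝ} (hp1 : p ≤ 1) (n : ℕ) : 1 - n * p ≤ (1 - p) ^ n := by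
  have h := one_add_mul_le_pow (a := -p) (by linarith) n
  have e : 1 + -p = 1 - p := by ring
  rw [e] at h
  linarith

/-- Many vertices of a set survive a sparse random sampling, by the second moment method. -/
lemma prob_card_core_ge {Y W : Finset V} {out : V → Finset V} {p μ : ℝ} {D m : ℕ}
    (hWY : W ⊆ Y) (hout : ∀ x, out x ⊆ Y) (hD : ∀ x ∈ Y, #(out x) ≤ D) (hself : ∀ x ∈ Y, x ∉ out x)
    (hp0 : 0 < p) (hp1 : p ≤ 1) (hpD : D * p ≤ 1 / 2) (hμ : #W * p = μ) (hm : 1 ≤ m)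
    (hμm : 16 * (m : ℝ) ≤ μ) :
    1 / 8 ≤ expect (fun _ => p) Y fun S => ind (m ≤ #{x ∈ W | x ∈ core out S}) := by
  have hmR : (1 : ℝ) ≤ m := by exact_mod_cast hm
  have hμ0 : 0 < μ := by linarith
  let Z : Finset V → ℝ := fun S => ∑ x ∈ W, ind (insert x ∅ ⊆ S ∧ Disjoint (out x) S)
  have hZ : ∀ S, (#{x ∈ W | x ∈ core out S} : ℝ) = Z S := by
    intro S
    rw [card_filter_eq_sum_ind]
    refine sum_congr rfl fun x _ => ?_
    congr 1
    simp [mem_core]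
  have h1 : μ / 2 ≤ expect (fun _ => p) Y Z := by
    simp only [Z]
    rw [expect_sum]
    have : μ / 2 = #W • (p / 2) := by rw [nsmul_eq_mul, ← hμ]; ring
    rw [this]
    refine card_nsmul_le_sum _ _ _ fun x hx => ?_
    have hxY := hWY hx
    rw [expect_ind_subset_disjoint (by simpa using hxY) (hout x) (by simpa using hself x hxY)]
    simp only [insert_empty_eq, prod_const, card_singleton, pow_one]
    have h2 := one_sub_mul_le_pow hp1 #(out x)
    have h3 : (#(out x) : ℝ) * p ≤ D * p := by
      have : (#(out x) : ℝ) ≤ D := by exact_mod_cast hD x hxY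
      gcongr
    have h4 : 1 / 2 ≤ (1 - p) ^ #(out x) := by linarith
    calc p / 2 = p * (1 / 2) := by ring
      _ ≤ _ := by gcongr
  have h2 : expect (fun _ => p) Y (fun S => Z S ^ 2) ≤ μ ^ 2 + μ := by
    have h3 : expect (fun _ => p) Y (fun S => Z S ^ 2) ≤
        expect (fun _ => p) Y (fun S => ∑ x ∈ W, ∑ y ∈ W, ind (insert y {x} ⊆ S)) := by
      refine expect_mono (fun _ _ => ⟨hp0.le, hp1⟩) fun S _ => ?_
      simp only [Z]
      rw [sq, sum_mul_sum]
      refine sum_le_sum fun x _ => sum_le_sum fun y _ => ?_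
      rw [ind_mul]
      refine ind_mono fun h => ?_
      have hx : x ∈ S := h.1.1 (by simp)
      have hy : y ∈ S := h.2.1 (by simp)
      simp [insert_subset_iff, hx, hy]
    refine h3.trans ?_
    rw [expect_sum]
    have : μ ^ 2 + μ = #W • (#W * p ^ 2 + 1 * p) := by rw [nsmul_eq_mul, ← hμ]; ring
    rw [this]
    refine sum_le_card_nsmul _ _ _ fun x hx => ?_
    rw [expect_sum]
    have h4 := sum_pow_card_insert_le hp0.le W {x} (card_singleton x) (le_refl #W)
    norm_num at h4 ⊢
    refine le_trans (le_of_eq ?_) h4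
    refine sum_congr rfl fun y hy => ?_
    rw [expect_ind_subset, prod_const]
    simp [insert_subset_iff, hWY hx, hWY hy]
  -- Pointwise, `(4 * μ - Z) * (Z - m)` is at most `4 * μ ^ 2` times the indicator of `m ≤ Z`; its
  -- expectation involves only the two moments bounded above.
  have h3 : expect (fun _ => p) Y (fun S => (4 * μ ^ 2)⁻¹ *
      ((4 * μ + m) * Z S - Z S ^ 2 - 4 * μ * m * ind (∅ ⊆ S))) ≤
      expect (fun _ => p) Y fun S => ind (m ≤ #{x ∈ W | x ∈ core out S}) := by
    refine expect_mono (fun _ _ => ⟨hp0.le, hp1⟩) fun S _ => ?_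
    rw [ind_of (empty_subset S), mul_one]
    have hμ2 : 0 < 4 * μ ^ 2 := by positivity
    rw [inv_mul_le_iff₀ hμ2]
    have hZ0 : 0 ≤ Z S := sum_nonneg fun _ _ => ind_nonneg _
    by_cases hc : m ≤ #{x ∈ W | x ∈ core out S}
    · rw [ind_of hc, mul_one]
      have hc' : (m : ℝ) ≤ Z S := by rw [← hZ]; exact_mod_cast hc
      nlinarith [sq_nonneg (Z S - 2 * μ)]
    · rw [ind_of_not hc, mul_zero]
      have hc' : Z S < m := by rw [← hZ]; exact_mod_cast not_le.1 hc
      nlinarith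
  refine le_trans ?_ h3
  rw [expect_const_mul, expect_sub, expect_sub, expect_const_mul, expect_const_mul,
    expect_ind_subset (empty_subset Y), prod_empty, mul_one]
  have hμ2 : 0 < 4 * μ ^ 2 := by positivity
  rw [le_inv_mul_iff₀ hμ2]
  have h5 : (4 * μ + m) * (μ / 2) ≤ (4 * μ + m) * expect (fun _ => p) Y Z := by gcongr
  nlinarith

/-- An independent set survives a sampling with the obvious probability. -/
lemma prob_subset_core_ge {Y I : Finset V} {out : V → Finset V} {p : ℝ} {D : ℕ}
    (hIY : I ⊆ Y) (hI : Indep G I) (hout : ∀ x, out x ⊆ Y) (hD : ∀ x ∈ Y, #(out x) ≤ D)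
    (hadj : ∀ x ∈ Y, ∀ y ∈ out x, G.Adj x y)
    (hp0 : 0 < p) (hp1 : p ≤ 1) (hpD : #I * D * p ≤ 1 / 2) :
    p ^ #I / 2 ≤ expect (fun _ => p) Y fun S => ind (I ⊆ core out S) := by
  -- Out-neighbours of the independent set `I` avoid `I`, so keeping `I` and missing `J` are
  -- independent events.
  set J := I.biUnion out with hJ
  have hIJ : Disjoint I J := by
    rw [disjoint_left]
    intro y hy hyJ
    obtain ⟨x, hx, hyx⟩ := mem_biUnion.1 hyJ
    exact hI x hx y hy (hadj x (hIY hx) y hyx)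
  have hJY : J ⊆ Y := biUnion_subset.2 fun x _ => hout x
  have hJc : #J ≤ #I * D := card_biUnion_le_card_mul _ _ _ fun x hx => hD x (hIY hx)
  have h1 : expect (fun _ => p) Y (fun S => ind (I ⊆ S ∧ Disjoint J S)) = p ^ #I * (1 - p) ^ #J := by
    rw [expect_ind_subset_disjoint hIY hJY hIJ, prod_const, prod_const]
  have h2 : expect (fun _ => p) Y (fun S => ind (I ⊆ S ∧ Disjoint J S)) ≤
      expect (fun _ => p) Y fun S => ind (I ⊆ core out S) := by
    refine expect_mono (fun _ _ => ⟨hp0.le, hp1⟩) fun S _ => ind_mono fun h x hx => ?_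
    exact mem_core.2 ⟨h.1 hx, disjoint_of_subset_left (subset_biUnion_of_mem out hx) h.2⟩
  refine le_trans ?_ h2
  rw [h1]
  have h3 := one_sub_mul_le_pow hp1 #J
  have h4 : (#J : ℝ) * p ≤ #I * D * p := by
    have : (#J : ℝ) ≤ #I * D := by exact_mod_cast hJc
    gcongr
  have h5 : 1 / 2 ≤ (1 - p) ^ #J := by linarith
  calc p ^ #I / 2 = p ^ #I * (1 / 2) := by ring
    _ ≤ _ := by gcongr

/-- Large sets of a graph without large bicliques contain independent sets of moderate size. -/
lemma BicliqueFree.exists_indep {s M a j : ℕ} (hK : BicliqueFree G s) (hM : 4 ≤ M) (hs : s ≤ M)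
    (ha : 2 * s ≤ M ^ a) (hj : (j + 2) * s + 2 ≤ a + j + 1) {W : Finset V}
    (hW : M ^ (a + j + 1) ≤ #W) : ∃ I ⊆ W, Indep G I ∧ #I = M ^ j := by
  obtain ⟨W₀, hW₀, hW₀c⟩ := exists_subset_card_eq hW
  -- The biclique bound makes these high-degree vertices a small part of `W₀`; greedy selection
  -- works on the remainder.
  set X := {x ∈ W₀ | M ^ a ≤ #(nb G W₀ x)} with hX
  have hXc : #X ≤ M ^ ((j + 1 + 1) * s + 1) :=
    hK.card_le_pow W₀ X (by omega) hs ha (by rw [hW₀c, add_assoc]) fun x hx => (mem_filter.1 hx).2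
  have hXc' : M * #X ≤ M ^ (a + j + 1) := by
    calc M * #X ≤ M * M ^ ((j + 1 + 1) * s + 1) := Nat.mul_le_mul_left _ hXc
      _ = M ^ ((j + 2) * s + 2) := by ring
      _ ≤ M ^ (a + j + 1) := Nat.pow_le_pow_right (by omega) hj
  obtain ⟨I, hI, hind, hc⟩ := exists_indep_of_degenerate (G := G) (D := M ^ a) (W₀ \ X)
    fun H hH hne => by
      obtain ⟨v, hv⟩ := hne
      refine ⟨v, hv, ?_⟩
      have hv' := mem_sdiff.1 (hH hv)
      have : ¬ M ^ a ≤ #(nb G W₀ v) := fun h => hv'.2 (mem_filter.2 ⟨hv'.1, h⟩)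
      exact (card_nb_mono (hH.trans sdiff_subset) v).trans (by omega)
  have h1 : M ^ (a + j + 1) ≤ #(W₀ \ X) + #X := by
    rw [← hW₀c]; exact card_le_card_sdiff_add_card
  have hpa : 1 ≤ M ^ a := Nat.one_le_pow _ _ (by omega)
  have h2 : M ^ j ≤ #I := by
    have e1 : (M ^ a + 1) * #I ≤ 2 * M ^ a * #I := by gcongr; omega
    have e2 : 4 * #X ≤ M * #X := by gcongr
    have e3 : M ^ a * (4 * M ^ j) ≤ M ^ (a + j + 1) := by
      calc M ^ a * (4 * M ^ j) ≤ M ^ a * (M * M ^ j) := by gcongr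
        _ = _ := by ring
    refine Nat.le_of_mul_le_mul_left (c := M ^ a) ?_ (by positivity)
    nlinarith
  obtain ⟨I', hI', hI'c⟩ := exists_subset_card_eq h2
  exact ⟨I', (hI'.trans hI).trans (sdiff_subset.trans hW₀), hind.mono hI', hI'c⟩

/-! ### From sparse or tiny sides to unbalanced bipartite graphs. -/

/-- The unbalanced case, when both sides are equally sparse. -/
lemma hasDenseC4Free_of_sparse_pair {s k M d : ℕ} (hK : BicliqueFree G s)
    (hkM : 2 * k + 32 ≤ M) (hsM : s ≤ M) (hdM : 2 * d + 71 * s + 40 ≤ M) {A Y : Finset V}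
    (hAY : Disjoint A Y) (hne : A.Nonempty) (hA : SparseOn G A (2 * M ^ d))
    (hY : SparseOn G Y (2 * M ^ d)) (hlo : ∀ a ∈ A, M ^ (d + 32 * s + 22) ≤ #(nb G Y a))
    (hhi : ∀ a ∈ A, #(nb G Y a) < M ^ (d + 39 * s + 28))
    (hcard : #Y ≤ M ^ (7 * s + 6) * #A) : HasDenseC4Free G k := by
  have hM0 : 0 < M := by omega
  have hMR : (32 : ℝ) ≤ M := by exact_mod_cast (by omega : 32 ≤ M)
  have hM1 : (1 : ℝ) ≤ M := by linarith
  have hMp : (0 : ℝ) < M := by linarith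
  obtain ⟨out, ho1, ho2, ho3, ho4⟩ := hY.exists_orientation
  -- Then `M ^ (d + 32 * s + 22)` neighbours leave a mean of `M ^ (7 * s + 3)`, while the required
  -- imbalance and the ratio of `#Y` to `#A` together cost `M ^ (d + 25 * s + 8)`, leaving `M ^ 11`
  -- to spare.
  set p : ℝ := ((M : ℝ) ^ (d + 25 * s + 19))⁻¹ with hp
  have hp0 : 0 < p := by positivity
  have hp1 : p ≤ 1 := inv_le_one_of_one_le₀ (one_le_pow₀ hM1)
  have hself : ∀ x ∈ Y, x ∉ out x := fun x hx hc => G.loopless.irrefl _ (ho3 x hx x hc)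
  have hpD : ((2 * M ^ d : ℕ) : ℝ) * p ≤ 1 / 2 := by
    have h1 : (M : ℝ) ^ (25 * s + 19) * M ^ d = M ^ (d + 25 * s + 19) := by ring
    have h2 : (4 : ℝ) ≤ M ^ (25 * s + 19) := by
      calc (4 : ℝ) ≤ M ^ 1 := by rw [pow_one]; linarith
        _ ≤ _ := pow_le_pow_right₀ hM1 (by omega)
    push_cast
    rw [hp, ← div_eq_mul_inv, div_le_iff₀ (by positivity), ← h1]
    have := mul_le_mul_of_nonneg_right h2 (by positivity : (0 : ℝ) ≤ M ^ d)
    linarith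
  have hApos : (0 : ℝ) < #A := by exact_mod_cast hne.card_pos
  obtain ⟨X, hXY, hX, hXc⟩ := exists_indep_of_prob (A := A) (π := 1 / 8) (m := M ^ (7 * s + 2))
    (l := (M : ℝ) ^ (18 * s + d + 2)) ho4 hp0.le hp1 (by positivity) (fun a ha => by
      obtain ⟨W, hW, hWc⟩ := exists_subset_card_eq (hlo a ha)
      refine (prob_card_core_ge (W := W) (m := M ^ (7 * s + 2)) (μ := (M : ℝ) ^ (7 * s + 3))
        (hW.trans (nb_subset _ _)) ho1 ho2 hself hp0 hp1 hpD ?_ (Nat.one_le_pow _ _ hM0) ?_).trans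
        (expect_mono (fun _ _ => ⟨hp0.le, hp1⟩) fun S _ => ind_mono fun h => h.trans
          (card_le_card fun x hx => ?_))
      · rw [hWc, hp, ← div_eq_mul_inv, div_eq_iff (by positivity)]
        push_cast
        ring
      · push_cast
        calc 16 * (M : ℝ) ^ (7 * s + 2) ≤ M * M ^ (7 * s + 2) := by gcongr; linarith
          _ = M ^ (7 * s + 3) := by ring
      · rw [mem_filter] at hx
        exact mem_nb.2 ⟨hx.2, (mem_nb.1 (hW hx.1)).2⟩)
    (by
      have h1 : (#Y : ℝ) ≤ M ^ (7 * s + 6) * #A := by exact_mod_cast hcard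
      have h2 : (M : ℝ) ^ (18 * s + d + 2) * p * M ^ (7 * s + 6) * M ^ 11 = 1 := by
        rw [hp]
        field_simp
        ring
      have h3 : (M : ℝ) ^ (18 * s + d + 2) * p * M ^ (7 * s + 6) < 1 / 8 := by
        have h4 : (32 : ℝ) ≤ M ^ 11 := hMR.trans (le_self_pow₀ hM1 (by norm_num))
        have h5 : 0 < (M : ℝ) ^ (18 * s + d + 2) * p * M ^ (7 * s + 6) := by positivity
        nlinarith
      calc (M : ℝ) ^ (18 * s + d + 2) * (p * #Y)
          ≤ M ^ (18 * s + d + 2) * (p * (M ^ (7 * s + 6) * #A)) := by gcongr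
        _ = M ^ (18 * s + d + 2) * p * M ^ (7 * s + 6) * #A := by ring
        _ < 1 / 8 * #A := by gcongr)
  set A₂ := {a ∈ A | M ^ (7 * s + 2) ≤ #(nb G X a)} with hA₂
  have hA₂A : A₂ ⊆ A := filter_subset _ _
  have hXc' : M ^ (18 * s + (d + 1) + 1) * #X < #A₂ := by
    have : 18 * s + (d + 1) + 1 = 18 * s + d + 2 := by ring
    rw [this]
    exact_mod_cast hXc
  refine hasDenseC4Free_of_unbalanced (x := d + 1) (n := d + 32 * s + 26) (A := A₂) (X := X) hK
    (by omega) hsM ?_ (by omega)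
    (disjoint_of_subset_left hA₂A (disjoint_of_subset_right hXY hAY))
    (card_pos.1 (by omega)) (hA.mono hA₂A) hX (fun a ha => (mem_filter.1 ha).2) ?_ hXc'.le
  · have : 1 ≤ M ^ d := Nat.one_le_pow _ _ hM0
    have : 32 * M ^ d ≤ M * M ^ d := Nat.mul_le_mul_right _ (by omega)
    rw [pow_succ']
    omega
  · intro a ha
    have : 7 * s + 2 + (d + 32 * s + 26) = d + 39 * s + 28 := by ring
    rw [this]
    exact (card_nb_mono hXY a).trans_lt (hhi a (hA₂A ha))

/-- The unbalanced case, when one side is far smaller than the other. -/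
lemma hasDenseC4Free_of_tiny_side {s k M d : ℕ} (hK : BicliqueFree G s)
    (hkM : 2 * k + 32 ≤ M) (hsM : s ≤ M) (hs : (7 * s + 4) * s ≤ d)
    (hdM : 2 * d + 71 * s + 40 ≤ M) {A Y : Finset V}
    (hAY : Disjoint A Y) (hne : A.Nonempty) (hA : SparseOn G A (2 * M ^ d))
    (hY : SparseOn G Y (4 * M ^ (d + 39 * s + 26)))
    (hlo : ∀ a ∈ A, M ^ (d + 32 * s + 22) ≤ #(nb G Y a))
    (hhi : ∀ a ∈ A, #(nb G Y a) < M ^ (d + 39 * s + 28))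
    (hcard : M ^ M ^ (7 * s + 3) * #Y ≤ M ^ (7 * s + 6) * #A) : HasDenseC4Free G k := by
  have hM0 : 0 < M := by omega
  have hMR : (32 : ℝ) ≤ M := by exact_mod_cast (by omega : 32 ≤ M)
  have hM1 : (1 : ℝ) ≤ M := by linarith
  have hMp : (0 : ℝ) < M := by linarith
  obtain ⟨out, ho1, ho2, ho3, ho4⟩ := hY.exists_orientation
  -- The out-degree bound now exceeds the lower bound on degrees into `Y`, so a mean value argument
  -- is not available. Instead `q` is `M / 4` times the bound on the out-neighbours of an `m`-set,
  -- which therefore survives with probability at least `p ^ m / 2`.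
  set q : ℕ := M ^ (d + 46 * s + 29) with hq
  set m : ℕ := M ^ (7 * s + 2) with hm
  set p : ℝ := ((q : ℕ) : ℝ)⁻¹ with hp
  have hq0 : 0 < q := by positivity
  have hq1 : (1 : ℝ) ≤ q := by exact_mod_cast hq0
  have hp0 : 0 < p := by positivity
  have hp1 : p ≤ 1 := inv_le_one_of_one_le₀ hq1
  have hpD : (m : ℝ) * ((4 * M ^ (d + 39 * s + 26) : ℕ) : ℝ) * p ≤ 1 / 2 := by
    rw [hp, ← div_eq_mul_inv, div_le_iff₀ (by positivity), hq, hm]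
    push_cast
    have h1 : (M : ℝ) ^ (d + 46 * s + 29) = M * (M ^ (7 * s + 2) * M ^ (d + 39 * s + 26)) := by ring
    rw [h1]
    have h2 : (0 : ℝ) ≤ M ^ (7 * s + 2) * M ^ (d + 39 * s + 26) := by positivity
    nlinarith
  have hApos : 0 < #A := hne.card_pos
  have ha' : 2 * s ≤ M ^ (d + 25 * s + 19) := by
    calc 2 * s ≤ M ^ 1 := by rw [pow_one]; omega
      _ ≤ _ := Nat.pow_le_pow_right hM0 (by omega)
  obtain ⟨X, hXY, hX, hXc⟩ := exists_indep_of_prob (A := A) (π := p ^ m / 2) (m := m)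
    (l := (M : ℝ) ^ (18 * s + d + 2)) ho4 hp0.le hp1 (by positivity) (fun a ha => by
      obtain ⟨I, hI, hind, hIc⟩ := hK.exists_indep (a := d + 25 * s + 19) (j := 7 * s + 2)
        (W := nb G Y a) (by omega) hsM ha' (by nlinarith)
        ((hlo a ha).trans' (le_of_eq (by congr 1; ring)))
      have h1 := prob_subset_core_ge (p := p) (hI.trans (nb_subset _ _)) hind ho1 ho2 ho3 hp0 hp1
        (by rw [hIc]; exact hpD)
      rw [hIc] at h1
      refine h1.trans (expect_mono (fun _ _ => ⟨hp0.le, hp1⟩) fun S _ => ind_mono fun h => ?_)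
      rw [hm, ← hIc]
      exact card_le_card fun x hx => mem_nb.2 ⟨h hx, (mem_nb.1 (hI hx)).2⟩)
    (by
      have h1 : M ^ (18 * s + d + 2) * #Y * (2 * q ^ m) < #A := by
        have hm1 : 1 ≤ m := Nat.one_le_pow _ _ hM0
        -- The exponent of the total loss is at most `(2 * d + 71 * s + 39) * m`, below `M * m = M ^
        -- (7 * s + 3)`.
        have hexp : (18 * s + d + 2) + 2 + (d + 46 * s + 29) * m + (7 * s + 6) ≤ M ^ (7 * s + 3) := by
          have e1 : M ^ (7 * s + 3) = M * m := by rw [hm]; ring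
          rw [e1]
          have e2 := Nat.mul_le_mul_right m hdM
          have e3 : (18 * s + d + 2 + 2 + (7 * s + 6)) * 1 ≤ (18 * s + d + 2 + 2 + (7 * s + 6)) * m :=
            Nat.mul_le_mul_left _ hm1
          nlinarith
        refine Nat.lt_of_mul_lt_mul_left (a := M ^ (7 * s + 6)) (lt_of_lt_of_le ?_ hcard)
        obtain ⟨a, ha⟩ := hne
        have hY0 : 0 < #Y := (Nat.pow_pos hM0).trans_le
          ((hlo a ha).trans (card_le_card (nb_subset _ _)))
        have h2 : 2 < M ^ 2 := by nlinarith
        calc M ^ (7 * s + 6) * (M ^ (18 * s + d + 2) * #Y * (2 * q ^ m))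
            = 2 * (M ^ (18 * s + d + 2) * q ^ m * M ^ (7 * s + 6) * #Y) := by ring
          _ < M ^ 2 * (M ^ (18 * s + d + 2) * q ^ m * M ^ (7 * s + 6) * #Y) :=
              Nat.mul_lt_mul_of_pos_right h2 (by positivity)
          _ = M ^ ((18 * s + d + 2) + 2 + (d + 46 * s + 29) * m + (7 * s + 6)) * #Y := by
              rw [hq, ← pow_mul]; ring
          _ ≤ M ^ M ^ (7 * s + 3) * #Y :=
              Nat.mul_le_mul_right _ (Nat.pow_le_pow_right hM0 hexp)
      have h2 : (M : ℝ) ^ (18 * s + d + 2) * #Y * (2 * q ^ m) < #A := by exact_mod_cast h1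
      have h3 : p ^ m / 2 * #A = #A / (2 * (q : ℝ) ^ m) := by
        rw [hp, inv_pow]; field_simp
      rw [h3, lt_div_iff₀ (by positivity)]
      refine lt_of_le_of_lt ?_ h2
      have h4 : p * #Y ≤ #Y := mul_le_of_le_one_left (by positivity) hp1
      gcongr)
  set A₂ := {a ∈ A | m ≤ #(nb G X a)} with hA₂
  have hA₂A : A₂ ⊆ A := filter_subset _ _
  have hXc' : M ^ (18 * s + (d + 1) + 1) * #X < #A₂ := by
    have : 18 * s + (d + 1) + 1 = 18 * s + d + 2 := by ring
    rw [this]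
    exact_mod_cast hXc
  refine hasDenseC4Free_of_unbalanced (x := d + 1) (n := d + 32 * s + 26) (A := A₂) (X := X) hK
    (by omega) hsM ?_ (by omega)
    (disjoint_of_subset_left hA₂A (disjoint_of_subset_right hXY hAY))
    (card_pos.1 (by omega)) (hA.mono hA₂A) hX (fun a ha => (mem_filter.1 ha).2) ?_ hXc'.le
  · have : 1 ≤ M ^ d := Nat.one_le_pow _ _ hM0
    have : 32 * M ^ d ≤ M * M ^ d := Nat.mul_le_mul_right _ (by omega)
    rw [pow_succ']
    omega
  · intro a ha
    have : 7 * s + 2 + (d + 32 * s + 26) = d + 39 * s + 28 := by ring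
    rw [this]
    exact (card_nb_mono hXY a).trans_lt (hhi a (hA₂A ha))

/-! ### Minimal dense sets, the layer decomposition and the dense case. -/

/-- A minimal set of average degree at least `2 * N` has no subset of much larger average
degree. -/
lemma exists_dense_sparseOn {N : ℕ} (hN : 1 ≤ N) {U₀ : Finset V} (hne : U₀.Nonempty)
    (hd : 2 * N * #U₀ ≤ degSum G U₀) :
    ∃ U : Finset V, U.Nonempty ∧ 2 * N * #U ≤ degSum G U ∧ SparseOn G U (4 * N) := by
  induction U₀ using Finset.strongInduction with
  | H U ih =>
    by_cases hc : ∃ H ⊂ U, H.Nonempty ∧ 2 * N * #H ≤ degSum G H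
    · obtain ⟨H, hHU, hH, hHd⟩ := hc
      exact ih H hHU hH hHd
    push Not at hc
    have hc' : ∀ H ⊂ U, degSum G H ≤ 2 * N * #H := by
      intro H hH
      rcases H.eq_empty_or_nonempty with rfl | h0
      · simp [degSum]
      · exact (hc H hH h0).le
    refine ⟨U, hne, hd, fun H hH => ?_⟩
    rcases hH.eq_or_ssubset with rfl | hss
    -- For the whole set, minimality bounds the degree sum after erasing one vertex, which itself
    -- accounts for at most `2 * #H`.
    · obtain ⟨v, hv⟩ := hne
      have h1 := degSum_le_of_subset (G := G) (erase_subset v H)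
      have h2 := hc' _ (erase_ssubset hv)
      have h3 : H \ H.erase v = {v} := by
        rw [sdiff_erase hv, sdiff_self]; rfl
      rw [h3, sum_singleton] at h1
      have h4 := card_le_card (nb_subset (G := G) H v)
      have h5 : #(H.erase v) ≤ #H := card_le_card (erase_subset _ _)
      have h6 : 2 * N * #(H.erase v) ≤ 2 * N * #H := Nat.mul_le_mul_left _ h5
      nlinarith
    · refine (hc' H hss).trans (Nat.mul_le_mul_right _ (by omega))

/-- The sets obtained from `U` by repeatedly restricting to the vertices of degree at least `T`. -/
noncomputable def layer (G : SimpleGraph V) (U : Finset V) (T : ℕ) : ℕ → Finset V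
  | 0 => U
  | i + 1 => {v ∈ layer G U T i | T ≤ #(nb G (layer G U T i) v)}

lemma layer_succ_subset (U : Finset V) (T i : ℕ) : layer G U T (i + 1) ⊆ layer G U T i :=
  filter_subset _ _

lemma layer_anti (U : Finset V) (T : ℕ) : Antitone (layer G U T) :=
  antitone_nat_of_succ_le (layer_succ_subset U T)

lemma layer_subset (U : Finset V) (T i : ℕ) : layer G U T i ⊆ U := layer_anti U T (Nat.zero_le i)

/-- By Markov's inequality, at most a fraction `1 / M` of a layer of average degree at most `D` has
degree at least `M * D`. -/
lemma card_layer_le {U : Finset V} {D M : ℕ} (hU : SparseOn G U D) (hD : 0 < D) (i : ℕ) :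
    M ^ i * #(layer G U (M * D) i) ≤ #U := by
  induction i with
  | zero => simp [layer]
  | succ i ih =>
    refine le_trans ?_ ih
    have h1 : #(layer G U (M * D) (i + 1)) * (M * D) ≤ D * #(layer G U (M * D) i) := by
      refine le_trans ?_ (hU _ (layer_subset U _ i))
      rw [← smul_eq_mul]
      refine (card_nsmul_le_sum _ _ _ fun v hv => (mem_filter.1 hv).2).trans ?_
      exact sum_le_sum_of_subset (layer_succ_subset U _ i)
    have h2 : M * #(layer G U (M * D) (i + 1)) ≤ #(layer G U (M * D) i) := by
      refine Nat.le_of_mul_le_mul_left (c := D) ?_ hD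
      calc D * (M * #(layer G U (M * D) (i + 1))) = #(layer G U (M * D) (i + 1)) * (M * D) := by ring
        _ ≤ _ := h1
    calc M ^ (i + 1) * #(layer G U (M * D) (i + 1)) = M ^ i * (M * #(layer G U (M * D) (i + 1))) := by
          ring
      _ ≤ _ := Nat.mul_le_mul_left _ h2

lemma card_nb_layer (U : Finset V) (T : ℕ) (a : V) (l : ℕ) :
    #(nb G (layer G U T 1) a) = ∑ i ∈ range l,
      #(nb G (layer G U T (i + 1) \ layer G U T (i + 2)) a) + #(nb G (layer G U T (l + 1)) a) := by
  induction l with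
  | zero => simp
  | succ l ih =>
    rw [ih, sum_range_succ, add_assoc, ← card_nb_union sdiff_disjoint,
      sdiff_union_of_subset (layer_succ_subset U T (l + 1))]

/-- The vertices with many neighbours in `Y` carry a large part of the edges from `A` to `Y`. -/
lemma sum_card_nb_le {A Y : Finset V} {T d : ℕ} (hT : ∀ a ∈ A, #(nb G Y a) ≤ T) :
    ∑ a ∈ A, #(nb G Y a) ≤ #{a ∈ A | d ≤ #(nb G Y a)} * T + #A * d := by
  have h1 : ∀ a ∈ A, #(nb G Y a) ≤ (if d ≤ #(nb G Y a) then T else 0) + d := by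
    intro a ha
    have := hT a ha
    split_ifs <;> omega
  refine (sum_le_sum h1).trans (le_of_eq ?_)
  rw [sum_add_distrib, ← sum_filter, sum_const, sum_const, smul_eq_mul, smul_eq_mul]

/-- Very dense graphs without large bicliques contain dense `C₄`-free induced subgraphs. -/
theorem hasDenseC4Free_of_dense {s k M : ℕ} (hK : BicliqueFree G s) (hkM : 2 * k + 32 ≤ M)
    (hsM : 1400 * s ^ 2 ≤ M) {U₀ : Finset V} (hne : U₀.Nonempty)
    (hd : 2 * M ^ (600 * s ^ 2 + 39 * s + 26) * #U₀ ≤ degSum G U₀) : HasDenseC4Free G k := by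
  have hs : 1 ≤ s := by
    by_contra! h0
    have h0' : s = 0 := by omega
    subst h0'
    exact hK ∅ ∅ card_empty card_empty (by simp)
  have hM0 : 0 < M := by omega
  have hss : s ≤ s ^ 2 := by nlinarith
  set d := 600 * s ^ 2 with hdd
  have hd0 : 1 ≤ d := by omega
  set N := M ^ (d + 39 * s + 26) with hN
  have hN0 : 0 < N := by positivity
  obtain ⟨U, hUne, hUd, hU⟩ := exists_dense_sparseOn hN0 hne hd
  by_contra hwin
  set T := M * (M * N) with hT
  have hTpow : T = M ^ (d + 39 * s + 28) := by rw [hT, hN]; ring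
  have hU' : SparseOn G U (M * N) := fun H hH =>
    (hU H hH).trans (Nat.mul_le_mul_right _ (Nat.mul_le_mul_right _ (by omega)))
  set B := layer G U T with hB
  set n := #U with hn
  have hBU : ∀ i, B i ⊆ U := layer_subset U T
  have hBc : ∀ i, M ^ i * #(B i) ≤ n := fun i => card_layer_le hU' (by positivity) i
  have hXdeg : ∀ i, ∀ v ∈ B i \ B (i + 1), #(nb G (B i) v) < T := by
    intro i v hv
    rw [mem_sdiff] at hv
    by_contra! hc
    exact hv.2 (mem_filter.2 ⟨hv.1, hc⟩)
  have hXs : ∀ i, SparseOn G (B i \ B (i + 1)) (2 * M ^ d) := by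
    intro i H hH
    by_contra! hlt
    have hHne : H.Nonempty := by
      rw [nonempty_iff_ne_empty]
      rintro rfl
      simp [degSum] at hlt
    have hdm : d - 1 + 1 = d := by omega
    have hbc : d - 1 + (39 * s + 29) = d + 39 * s + 28 := by omega
    -- Here `M ^ (b + c) = T` fixes `c`, and `f + 3 * c = b` fixes `f`; the biclique condition on
    -- `f` is then quadratic in `s`, which is why `d` is.
    refine hwin (hasDenseC4Free_of_degree_le (M := M) (b := d - 1) (c := 39 * s + 29)
      (f := d - 117 * s - 88) hK (by omega) (by omega) ?_ (by omega) ?_ (by omega) hHne ?_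
      (by rw [hdm]; exact hlt.le))
    · calc 2 * s ≤ M ^ 1 := by rw [pow_one]; omega
        _ ≤ _ := Nat.pow_le_pow_right hM0 (by omega)
    · have : d - 1 + (39 * s + 29) - (d - 117 * s - 88) + 1 = 156 * s + 117 := by omega
      rw [this]
      have e : (156 * s + 117) * s = 156 * s ^ 2 + 117 * s := by ring
      rw [e]
      omega
    · intro v hv
      rw [hbc, ← hTpow]
      exact ((card_nb_mono (hH.trans sdiff_subset) v).trans_lt (hXdeg i v (hH hv))).le
  set A := B 0 \ B 1 with hA
  have hB0 : B 0 = U := rfl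
  have hAU : A ⊆ U := sdiff_subset
  have hAB : Disjoint A (B 1) := sdiff_disjoint
  -- Few edges lie inside `A`, which is sparse, or inside `B 1`, which has at most `n / M` vertices
  -- and average degree at most `4 * N`.
  have hsum : N * n ≤ 2 * ∑ a ∈ A, #(nb G (B 1) a) := by
    have h1 := degSum_union (G := G) hAB
    have h2 : A ∪ B 1 = U := sdiff_union_of_subset (hBU 1)
    rw [h2] at h1
    have h3 : degSum G A ≤ 2 * M ^ d * #A := hXs 0 A subset_rfl
    have h4 : degSum G (B 1) ≤ 4 * N * #(B 1) := hU _ (hBU 1)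
    have h5 : M ^ 1 * #(B 1) ≤ n := hBc 1
    have h6 : 32 * #(B 1) ≤ M ^ 1 * #(B 1) := Nat.mul_le_mul_right _ (by rw [pow_one]; omega)
    have h7 : #A ≤ n := card_le_card hAU
    have h8 : 32 * M ^ d ≤ N := by
      calc 32 * M ^ d ≤ M * M ^ d := Nat.mul_le_mul_right _ (by omega)
        _ = M ^ (d + 1) := by ring
        _ ≤ N := Nat.pow_le_pow_right hM0 (by omega)
    have h9 : 32 * M ^ d * #A ≤ N * n := Nat.mul_le_mul h8 h7
    have h10 : N * (32 * #(B 1)) ≤ N * n := Nat.mul_le_mul_left _ (h6.trans h5)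
    nlinarith
  have hAdeg : ∀ Y ⊆ U, ∀ a ∈ A, #(nb G Y a) < T := fun Y hY a ha =>
    (card_nb_mono hY a).trans_lt (hXdeg 0 a ha)
  -- Pigeonholing over `L` pieces loses only a power of `M`, while the last layer is smaller by the
  -- factor `M ^ L` that the tiny case needs.
  set L := M ^ (7 * s + 3) with hL
  have hL1 : 1 ≤ L := Nat.one_le_pow _ _ hM0
  -- Vertices below the degree threshold carry at most `N * n / (8 * L)` edges, and every other
  -- vertex carries at most `T = M ^ 2 * N`.
  have main : ∀ Y ⊆ U, N * n ≤ 4 * L * ∑ a ∈ A, #(nb G Y a) →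
      n ≤ M ^ (7 * s + 6) * #{a ∈ A | M ^ (d + 32 * s + 22) ≤ #(nb G Y a)} := by
    intro Y hY hYs
    have h1 := sum_card_nb_le (G := G) (A := A) (Y := Y) (d := M ^ (d + 32 * s + 22))
      fun a ha => (hAdeg Y hY a ha).le
    set A₁ := {a ∈ A | M ^ (d + 32 * s + 22) ≤ #(nb G Y a)} with hA₁
    have h2 : #A ≤ n := card_le_card hAU
    have h3 : 8 * L * M ^ (d + 32 * s + 22) ≤ N := by
      calc 8 * L * M ^ (d + 32 * s + 22) ≤ M * L * M ^ (d + 32 * s + 22) := by gcongr; omega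
        _ = N := by rw [hL, hN]; ring
    have h4 : 8 * L * M ^ (d + 32 * s + 22) * #A ≤ N * n := Nat.mul_le_mul h3 h2
    have h5 : N * n ≤ 8 * L * (#A₁ * T) := by nlinarith
    refine Nat.le_of_mul_le_mul_left (c := N) ?_ hN0
    calc N * n ≤ 8 * L * (#A₁ * T) := h5
      _ ≤ M * L * (#A₁ * T) := by gcongr; omega
      _ = N * (M ^ (7 * s + 6) * #A₁) := by rw [hL, hT]; ring
  have hn0 : 0 < n := hUne.card_pos
  have hne' : ∀ K : Finset V, n ≤ M ^ (7 * s + 6) * #K → K.Nonempty := by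
    intro K hK
    rw [← card_pos]
    exact Nat.pos_of_ne_zero fun h0 => by rw [h0] at hK; omega
  have hds : (7 * s + 4) * s ≤ d := by nlinarith
  by_cases hcase : ∃ i < L - 1,
      N * n ≤ 4 * L * ∑ a ∈ A, #(nb G (B (i + 1) \ B (i + 2)) a)
  · obtain ⟨i, -, hi⟩ := hcase
    set Y := B (i + 1) \ B (i + 2) with hY
    have hYU : Y ⊆ U := sdiff_subset.trans (hBU _)
    have hm := main Y hYU hi
    have hYB : Y ⊆ B 1 := sdiff_subset.trans (layer_anti U T (by omega))
    refine hwin (hasDenseC4Free_of_sparse_pair (d := d) (Y := Y)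
      (A := {a ∈ A | M ^ (d + 32 * s + 22) ≤ #(nb G Y a)}) hK hkM (by omega) (by omega)
      (disjoint_of_subset_left (filter_subset _ _) (disjoint_of_subset_right hYB hAB))
      (hne' _ hm) ((hXs 0).mono (filter_subset _ _)) (hXs (i + 1))
      (fun a ha => (mem_filter.1 ha).2) (fun a ha => ?_) ((card_le_card hYU).trans hm))
    rw [← hTpow]
    exact hAdeg Y hYU a (mem_filter.1 ha).1
  · push Not at hcase
    set Y := B L with hY
    have hYU : Y ⊆ U := hBU _
    have hL' : L - 1 + 1 = L := by omega
    have hi : N * n ≤ 4 * L * ∑ a ∈ A, #(nb G Y a) := by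
      have h1 : ∑ a ∈ A, #(nb G (B 1) a) = ∑ i ∈ range (L - 1),
          ∑ a ∈ A, #(nb G (B (i + 1) \ B (i + 2)) a) + ∑ a ∈ A, #(nb G Y a) := by
        rw [sum_comm, ← sum_add_distrib]
        refine sum_congr rfl fun a _ => ?_
        have := card_nb_layer (G := G) U T a (L - 1)
        rwa [hL'] at this
      by_contra! hlt
      have h2 : ∑ i ∈ range (L - 1), 4 * L * ∑ a ∈ A, #(nb G (B (i + 1) \ B (i + 2)) a) ≤
          (L - 1) * (N * n) := by
        refine (sum_le_card_nsmul _ _ (N * n) fun i hi => (hcase i (mem_range.1 hi)).le).trans ?_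
        rw [card_range, smul_eq_mul]
      rw [← mul_sum] at h2
      have h3 : (L - 1) * (N * n) + N * n = L * (N * n) := by
        rw [← Nat.succ_mul, Nat.succ_eq_add_one, hL']
      have h4 : 4 * L * ∑ a ∈ A, #(nb G (B 1) a) < L * (N * n) := by
        rw [h1, mul_add]; omega
      have h5 : L * (N * n) ≤ L * (2 * ∑ a ∈ A, #(nb G (B 1) a)) := Nat.mul_le_mul_left _ hsum
      nlinarith [Nat.zero_le (L * ∑ a ∈ A, #(nb G (B 1) a))]
    have hm := main Y hYU hi
    have hYB : Y ⊆ B 1 := layer_anti U T hL1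
    refine hwin (hasDenseC4Free_of_tiny_side (d := d) (Y := Y)
      (A := {a ∈ A | M ^ (d + 32 * s + 22) ≤ #(nb G Y a)}) hK hkM (by omega) hds (by omega)
      (disjoint_of_subset_left (filter_subset _ _) (disjoint_of_subset_right hYB hAB))
      (hne' _ hm) ((hXs 0).mono (filter_subset _ _)) (hU.mono hYU)
      (fun a ha => (mem_filter.1 ha).2) (fun a ha => ?_) ((hBc L).trans hm))
    rw [← hTpow]
    exact hAdeg Y hYU a (mem_filter.1 ha).1

/-! ### Translation to subgraph containment, and the final choice of constants. -/

lemma bicliqueFree_of_free {s : ℕ} (h : (completeBipartiteGraph (Fin s) (Fin s)).Free G) :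
    BicliqueFree G s := by
  intro T X hT hX hTX
  refine h ⟨⟨⟨Sum.elim (fun i => (T.equivFinOfCardEq hT).symm i)
    (fun i => (X.equivFinOfCardEq hX).symm i), ?_⟩, ?_⟩⟩
  · rintro (i | i) (j | j) hij
    · simp at hij
    · exact hTX _ (coe_mem _) _ (coe_mem _)
    · exact (hTX _ (coe_mem _) _ (coe_mem _)).symm
    · simp at hij
  · have hne : ∀ t ∈ T, ∀ x ∈ X, t ≠ x := fun t ht x hx => (hTX t ht x hx).ne
    rintro (i | i) (j | j) hij
    · simpa using hij
    · exact absurd hij (hne _ (coe_mem _) _ (coe_mem _))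
    · exact absurd hij.symm (hne _ (coe_mem _) _ (coe_mem _))
    · simpa using hij

lemma degSum_univ_eq [Fintype V] : degSum G univ = 2 * G.edgeSet.ncard := by
  rw [Set.ncard_eq_toFinset_card', ← SimpleGraph.edgeFinset, ← G.sum_degrees_eq_twice_card_edges,
    degSum]
  refine sum_congr rfl fun v _ => ?_
  rw [← SimpleGraph.card_neighborFinset_eq_degree]
  congr 1
  ext u
  simp

lemma degSum_induce (S : Finset V) : degSum (G.induce (S : Set V)) univ = degSum G S := by
  rw [degSum, degSum, ← sum_coe_sort S]
  refine sum_congr rfl fun v _ => ?_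
  refine card_bij (fun u _ => (u : V)) ?_ ?_ ?_
  · intro u hu
    simpa using hu
  · intro u _ w _ h
    exact Subtype.ext h
  · intro u hu
    rw [mem_nb] at hu
    exact ⟨⟨u, hu.1⟩, by simpa using hu.2, rfl⟩

lemma HasDenseC4Free.exists_set {k : ℕ} (h : HasDenseC4Free G k) :
    ∃ S : Set V, S.Nonempty ∧ (SimpleGraph.cycleGraph 4).Free (G.induce S) ∧
      (k : ℝ) ≤ (G.induce S).avgDegree := by
  obtain ⟨S, hS, hC4, hk⟩ := h
  refine ⟨S, hS, ?_, ?_⟩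
  · rintro ⟨φ⟩
    have hadj : ∀ i j : Fin 4, (SimpleGraph.cycleGraph 4).Adj i j → G.Adj (φ i) (φ j) :=
      fun i j hij => φ.toHom.map_adj hij
    have hinj : ∀ i j : Fin 4, i ≠ j → (φ i : V) ≠ φ j :=
      fun i j hij h => hij (φ.injective (Subtype.ext h))
    exact hC4 _ (φ 0).2 _ (φ 1).2 _ (φ 2).2 _ (φ 3).2 (hinj 0 2 (by decide)) (hinj 1 3 (by decide))
      (hadj 0 1 (by decide)) (hadj 1 2 (by decide)) (hadj 2 3 (by decide)) (hadj 3 0 (by decide))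
  · have hpos : (0 : ℝ) < #S := by exact_mod_cast hS.card_pos
    have h1 : Nat.card (S : Set V) = #S := by simp
    rw [SimpleGraph.avgDegree, h1, le_div_iff₀ hpos]
    rw [← degSum_induce, degSum_univ_eq] at hk
    exact_mod_cast hk

lemma hasDenseC4Free_zero [Nonempty V] : HasDenseC4Free G 0 := by
  obtain ⟨v⟩ := ‹Nonempty V›
  refine ⟨{v}, singleton_nonempty v, ?_, by simp⟩
  intro a ha _ _ x hx _ _ hax
  rw [mem_singleton] at ha hx
  exact absurd (ha.trans hx.symm) hax

lemma hasDenseC4Free_one {u v : V} (h : G.Adj u v) : HasDenseC4Free G 1 := by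
  refine ⟨{u, v}, insert_nonempty _ _, ?_, ?_⟩
  · intro a ha b hb x hx _ _ hax _ hab hbx _ _
    simp only [mem_insert, mem_singleton] at ha hb hx
    rcases ha with rfl | rfl <;> rcases hb with rfl | rfl <;> rcases hx with rfl | rfl <;>
      first | exact hax rfl | exact G.loopless.irrefl _ hab | exact G.loopless.irrefl _ hbx
  · rw [one_mul, degSum, card_eq_sum_ones]
    refine sum_le_sum fun w hw => card_pos.2 ?_
    simp only [mem_insert, mem_singleton] at hw
    rcases hw with rfl | rfl
    · exact ⟨v, by simp [h]⟩
    · exact ⟨u, by simp [h.symm]⟩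

lemma sq_mul_le_two_pow {s : ℕ} (hs : 1 ≤ s) : 1400 * s ^ 2 ≤ 2 ^ (20 * s) := by
  have h1 : s ≤ 2 ^ s := Nat.lt_two_pow_self.le
  have h2 : 1400 ≤ 2 ^ (18 * s) := by
    calc 1400 ≤ 2 ^ (18 * 1) := by norm_num
      _ ≤ 2 ^ (18 * s) := Nat.pow_le_pow_right (by norm_num) (by omega)
  calc 1400 * s ^ 2 ≤ 2 ^ (18 * s) * (2 ^ s) ^ 2 := by gcongr
    _ = 2 ^ (20 * s) := by ring

end InducedC4Free

open InducedC4Free in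
theorem theorem1p1 :
    ∃ C : ℕ, ∀ (s k : ℕ) (V : Type*) [Finite V] [Nonempty V] (G : SimpleGraph V),
      (completeBipartiteGraph (Fin s) (Fin s)).Free G →
      (k : ℝ) ^ (C * s ^ 3) ≤ G.avgDegree →
      ∃ S : Set V, S.Nonempty ∧
        (SimpleGraph.cycleGraph 4).Free (G.induce S) ∧
        (k : ℝ) ≤ (G.induce S).avgDegree := by
  -- For `k ≥ 2` the base is `M = k ^ (20 * s)`, large enough for `2 * k + 32` and `1400 * s ^ 2`.
  -- The constant is `12000 + 780 + 520 + 1`: the exponent `20 * s * (600 * s ^ 2 + 39 * s + 26)`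
  -- with lower powers raised to `s ^ 3`, plus one for the factor `2 ≤ k`.
  refine ⟨13301, fun s k V _ _ G hfree hd => ?_⟩
  classical
  have := Fintype.ofFinite V
  have hK := bicliqueFree_of_free hfree
  have hs : 1 ≤ s := by
    by_contra! h0
    obtain rfl : s = 0 := by omega
    exact hK ∅ ∅ rfl rfl (by simp)
  refine HasDenseC4Free.exists_set ?_
  have hV : (0 : ℝ) < Fintype.card V := by exact_mod_cast Fintype.card_pos
  have hdeg : (k : ℝ) ^ (13301 * s ^ 3) * Fintype.card V ≤ degSum G Finset.univ := by
    rw [SimpleGraph.avgDegree, Nat.card_eq_fintype_card, le_div_iff₀ hV] at hd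
    rw [degSum_univ_eq]
    exact_mod_cast hd
  have hdeg' : k ^ (13301 * s ^ 3) * Fintype.card V ≤ degSum G Finset.univ := by
    exact_mod_cast hdeg
  -- Powers of `k < 2` do not grow; there a single vertex or edge suffices.
  rcases Nat.lt_or_ge k 2 with hk | hk
  · rcases Nat.eq_zero_or_pos k with rfl | hk0
    · exact hasDenseC4Free_zero
    · obtain rfl : k = 1 := by omega
      rw [one_pow, one_mul] at hdeg'
      by_cases hadj : ∃ u v, G.Adj u v
      · obtain ⟨u, v, huv⟩ := hadj
        exact hasDenseC4Free_one huv
      · push Not at hadj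
        have h0 : degSum G Finset.univ = 0 := Finset.sum_eq_zero fun v _ => by
          rw [Finset.card_eq_zero, Finset.eq_empty_iff_forall_notMem]
          intro u hu
          exact hadj v u (mem_nb.1 hu).2
        have := Fintype.card_pos (α := V)
        omega
  · have hkM : 2 * k + 32 ≤ k ^ (20 * s) := by
      calc 2 * k + 32 ≤ k ^ 18 * k ^ 2 := by
            have h1 : 2 ^ 18 ≤ k ^ 18 := Nat.pow_le_pow_left hk 18
            nlinarith
        _ = k ^ 20 := by ring
        _ ≤ k ^ (20 * s) := Nat.pow_le_pow_right (by omega) (by omega)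
    have hsM : 1400 * s ^ 2 ≤ k ^ (20 * s) :=
      (sq_mul_le_two_pow hs).trans (Nat.pow_le_pow_left hk _)
    refine hasDenseC4Free_of_dense (M := k ^ (20 * s)) hK hkM hsM Finset.univ_nonempty
      (le_trans ?_ hdeg')
    refine Nat.mul_le_mul ?_ le_rfl
    calc 2 * (k ^ (20 * s)) ^ (600 * s ^ 2 + 39 * s + 26)
        ≤ k ^ 1 * k ^ (20 * s * (600 * s ^ 2 + 39 * s + 26)) := by
          rw [← pow_mul, pow_one]
          exact Nat.mul_le_mul_right _ hk
      _ = k ^ (1 + 20 * s * (600 * s ^ 2 + 39 * s + 26)) := (pow_add _ _ _).symm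
      _ ≤ k ^ (13301 * s ^ 3) := by
          refine Nat.pow_le_pow_right (by omega) ?_
          have h1 : s ^ 2 ≤ s ^ 3 := Nat.pow_le_pow_right hs (by norm_num)
          have h2 : s ≤ s ^ 3 := Nat.le_self_pow (by norm_num) s
          have h3 : 20 * s * (600 * s ^ 2 + 39 * s + 26) = 12000 * s ^ 3 + 780 * s ^ 2 + 520 * s := by
            ring
          rw [h3]
          omega
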